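/- **Theorem (PUC-Logic is decidable).** Both derivability and validity of PUC-Logic formulas are decidable: there are algorithms that decide (i) for a given formula $\alpha\in F_n$ whether it is a theorem, $\vdash\alpha$, of the natural deduction system PUC-ND; (ii) for a given $\alpha\in F_n$ whether it is an n-tautology; (iii) for a given $\alpha\in F_w$ whether it is a w-tautology. (Formulas are given by their numbers in a fixed injective effective numbering.) *Formulas.* There are countably many proposition symbols $p_i$, neighbourhood variables $N,M,P,\dots$ and world variables $u,\dots$. Neighbourhood labels are $\circledast$ (universal), $\circledcirc$ (existential) and the neighbourhood variables; world labels are $\ast$ (universal), $\bullet$ (existential) and the world variables. The sets $F_n$, $F_w$ of formulas are the least with: $p_i,\top_n,\bot_n\in F_n$; $\top_w,\bot_w\in F_w$; $\uparrow\! N,\ \downarrow\! N\in F_w$ for each neighbourhood variable $N$; each of $F_n$, $F_w$ is closed under $\neg,\wedge,\vee,\to$; if $\alpha\in F_n$ and $\phi$ is a world label, then $\alpha^{\phi}\in F_w$; if $\alpha\in F_w$ and $\phi$ is a neighbourhood label, then $\alpha^{\phi}\in F_n$. *Semantics.* A frame is a nonempty set $W$ of worlds with a function $\$$ assigning to each world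 a set of subsets of $W$ totally ordered by inclusion, and a set $V(p)\subseteq W$ for each proposition symbol. A model adds a reference world $\chi\in W$; a template adds to a model a set $S\in\$(\chi)$. An assignment $\sigma$ maps world variables to worlds and neighbourhood variables to nonempty subsets of $W$. Formulas of $F_n$ are evaluated at models (written $\chi$), those of $F_w$ at templates (written $(\chi,S)$); connectives, $\top$ and $\bot$ are classical, and $\chi\models p$ iff $\chi\in V(p)$; $\chi\models\alpha^{\circledast}$ (resp. $\alpha^{\circledcirc}$) iff $(\chi,S)\models\alpha$ for all (resp. some) $S\in\$(\chi)$; $\chi\models\alpha^{N}$ iff $\sigma(N)\in\$(\chi)$ and $(\chi,\sigma(N))\models\alpha$; $(\chi,S)\models\alpha^{\ast}$ (resp. $\alpha^{\bullet}$) iff $w\models\alpha$ for all (resp. some) $w\in S$; $(\chi,S)\models\alpha^{u}$ iff $\sigma(u)\in S$ and $\sigma(u)\models\alpha$; $(\chi,S)\models\ \uparrow\! M$ (resp. $\downarrow\! M$) iff $\sigma(M)\in\$(\chi)$ and $\sigma(M)\subseteq S$ (resp. $S\subseteq\sigma(M)$). An n-tautology (w-tautology) is a formula of $F_n$ ($F_w$)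 true in every model (template) under every assignment. *The system PUC-ND.* A context $\Delta$ is a stack (finite sequence, top on the right) of labels; $\alpha$ fits into $\Delta$ if labelling $\alpha$ successively by the labels of $\Delta$, from the top down, yields a formula of $F_n$. A derivation is a tree of judgements $\Delta:\alpha$ with $\alpha$ fitting into $\Delta$; all displayed formulas must fit. Brackets mark discharged hypotheses; $\bot,\top$ stand for the constants of the kind that fits; $\neg\alpha$ is interchangeable with $\alpha\to\bot$ in the rules for $\to$. The rules are: (1,2) $\Delta:\alpha\wedge\beta\ /\ \Delta:\alpha$ and $/\ \Delta:\beta$; (3) $\Delta:\alpha,\ \Delta:\beta\ /\ \Delta:\alpha\wedge\beta$; in (1–3) $\Delta$ has no $\circledcirc,\bullet$. (4,6) $\Delta:\alpha\ /\ \Delta:\alpha\vee\beta$ and $\Delta:\beta\ /\ \Delta:\alpha\vee\beta$; (5) $\Delta:\alpha\vee\beta,\ [\Delta:\alpha]\dots\Theta:\gamma,\ [\Delta:\beta]\dots\Theta:\gamma\ /\ \Theta:\gamma$; in (4–6) $\Delta$ has no $\circledast,\ast$. (7) $[\Delta:\neg\alpha]\dots\Delta:\bot\ /\ \Delta:\alpha$.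 (8) $\Delta:\bot\ /\ \Delta:\alpha$. (9) $\Delta:\bot\ /\ \bot_n$ in the empty context, if $\Delta$ is nonempty and has no $\circledast$. (10) From the hypothesis $\Delta:\alpha$ infer $\Delta:\alpha$. (11) $[\Delta:\alpha]\dots\Delta:\beta\ /\ \Delta:\alpha\to\beta$. (12) $\Delta:\alpha,\ \Delta:\alpha\to\beta\ /\ \Delta:\beta$, if $\Delta$ has no $\circledcirc,\bullet$. (13,14) $\Delta:\alpha^{\phi}\ /\ \Delta,\phi:\alpha$ and conversely. (15) $\Delta,u:\alpha\ /\ \Delta,\ast:\alpha$, if $u$ occurs in no open hypothesis on which the premise depends nor in the context of one. (16) $\Delta,\ast:\alpha\ /\ \Delta,u:\alpha$, if $u$ does not occur in $\alpha,\Delta$. (17) $\Delta,u:\alpha\ /\ \Delta,\bullet:\alpha$. (18) $\Delta,\bullet:\alpha,\ [\Delta,u:\alpha]\dots\Theta:\beta\ /\ \Theta:\beta$, if $u$ does not occur in $\alpha,\Delta,\Theta$ or in any remaining open hypothesis or its context. (19) $\Delta,N:\alpha,\ \Delta,\circledcirc:\beta\ /\ \Delta,\circledcirc:\alpha$. (20)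 $\Delta,\circledcirc:\alpha,\ [\Delta,N:\alpha]\dots\Theta:\beta\ /\ \Theta:\beta$, if $N$ does not occur in $\alpha,\Delta,\Theta$ or in any remaining open hypothesis or its context. (21) $\Delta,N:\alpha\ /\ \Delta,\circledast:\alpha$, if $N$ occurs in no open hypothesis on which the premise depends nor in the context of one. (22) $\Delta,\circledast:\alpha,\ \Delta,N:\beta\ /\ \Delta,N:\alpha$. (23) $\Delta,N:\alpha^{\bullet},\ \Delta,M:\uparrow\! N\ /\ \Delta,M:\alpha^{\bullet}$. (24) $\Delta,N:\alpha^{\ast},\ \Delta,M:\downarrow\! N\ /\ \Delta,M:\alpha^{\ast}$. (25) $\Delta,N:\uparrow\! M,\ \Delta,M:\uparrow\! P\ /\ \Delta,N:\uparrow\! P$. (26) The same with $\downarrow$. (27) $[\Delta,N:\uparrow\! M]\dots\Theta:\alpha,\ [\Delta,M:\uparrow\! N]\dots\Theta:\alpha\ /\ \Theta:\alpha$. (28) The same with $\downarrow$. (29) $[\Delta,M:\uparrow\! N]\dots\Theta:\alpha,\ [\Delta,M:\downarrow\! N]\dots\Theta:\alpha\ /\ \Theta:\alpha$. (30) $\Delta:\top$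 without premises, if $\Delta$ has no $\circledcirc$. A formula $\alpha\in F_n$ is a theorem, $\vdash\alpha$, if it has a derivation in the empty context without open hypotheses. -/

import Mathlib

universe u

namespace PUC

/-- The two kinds of formulas: neighbourhood formulas `F_n` (evaluated at models) and
world formulas `F_w` (evaluated at templates). -/
inductive Kind : Type
  | n
  | w

/-- Neighbourhood labels: `⊛` (`all`), `⊚` (`ex`) and the neighbourhood variables. -/
inductive NLabel : Type
  | all : NLabel
  | ex : NLabel
  | var (N : ℕ) : NLabel

/-- World labels: `∗` (`all`), `•` (`ex`) and the world variables. -/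
inductive WLabel : Type
  | all : WLabel
  | ex : WLabel
  | var (z : ℕ) : WLabel

/-- Well-formed formulas: `Fml .n` is `F_n` and `Fml .w` is `F_w`.
`incl N` is the constant saying that `N` is contained in the reference neighbourhood,
`cont N` the one saying that the reference neighbourhood is contained in `N`.
A world label turns a formula of `F_n` into one of `F_w` and
a neighbourhood label turns a formula of `F_w` into one of `F_n`. -/
inductive Fml : Kind → Type
  | atom (p : ℕ) : Fml .n
  | incl (N : ℕ) : Fml .w
  | cont (N : ℕ) : Fml .w
  | top {s : Kind} : Fml s
  | bot {s : Kind} : Fml s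
  | neg {s : Kind} (α : Fml s) : Fml s
  | and {s : Kind} (α β : Fml s) : Fml s
  | or {s : Kind} (α β : Fml s) : Fml s
  | imp {s : Kind} (α β : Fml s) : Fml s
  | byW (φ : WLabel) (α : Fml .n) : Fml .w
  | byN (φ : NLabel) (α : Fml .w) : Fml .n

/-! ### Goedel numbering -/

def NLabel.code : NLabel → ℕ
  | .all => 0
  | .ex => 1
  | .var N => N + 2

def WLabel.code : WLabel → ℕ
  | .all => 0
  | .ex => 1
  | .var z => z + 2

/-- Goedel number of a formula. -/
def Fml.code : {s : Kind} → Fml s → ℕ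
  | _, .atom p => Nat.pair 0 p
  | _, .incl N => Nat.pair 1 N
  | _, .cont N => Nat.pair 2 N
  | _, .top => Nat.pair 3 0
  | _, .bot => Nat.pair 4 0
  | _, .neg α => Nat.pair 5 α.code
  | _, .and α β => Nat.pair 6 (Nat.pair α.code β.code)
  | _, .or α β => Nat.pair 7 (Nat.pair α.code β.code)
  | _, .imp α β => Nat.pair 8 (Nat.pair α.code β.code)
  | _, .byW φ α => Nat.pair 9 (Nat.pair φ.code α.code)
  | _, .byN φ α => Nat.pair 10 (Nat.pair φ.code α.code)

theorem NLabel.code_injective : Function.Injective NLabel.code := by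
  intro a b h
  cases a <;> cases b <;> simp_all [NLabel.code]

theorem WLabel.code_injective : Function.Injective WLabel.code := by
  intro a b h
  cases a <;> cases b <;> simp_all [WLabel.code]

theorem Fml.code_injective {s : Kind} : Function.Injective (Fml.code (s := s)) := by
  intro a
  induction a with
  | byW φ α ih =>
    intro b h
    cases b <;> simp [Fml.code, Nat.pair_eq_pair] at h
    exact congrArg₂ _ (WLabel.code_injective h.1) (ih h.2)
  | byN φ α ih =>
    intro b h
    cases b <;> simp [Fml.code, Nat.pair_eq_pair] at h
    exact congrArg₂ _ (NLabel.code_injective h.1) (ih h.2)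
  | neg α ih =>
    intro b h
    cases b <;> simp [Fml.code, Nat.pair_eq_pair] at h
    exact congrArg _ (ih h)
  | and α β ih₁ ih₂ =>
    intro b h
    cases b <;> simp [Fml.code, Nat.pair_eq_pair] at h
    exact congrArg₂ _ (ih₁ h.1) (ih₂ h.2)
  | or α β ih₁ ih₂ =>
    intro b h
    cases b <;> simp [Fml.code, Nat.pair_eq_pair] at h
    exact congrArg₂ _ (ih₁ h.1) (ih₂ h.2)
  | imp α β ih₁ ih₂ =>
    intro b h
    cases b <;> simp [Fml.code, Nat.pair_eq_pair] at h
    exact congrArg₂ _ (ih₁ h.1) (ih₂ h.2)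
  | _ =>
    intro b h
    cases b <;> simp_all [Fml.code, Nat.pair_eq_pair]

/-! ### Semantics -/

/-- A frame on the set of worlds `W`: `nest` is the nesting function `$` and
`val` assigns a set of worlds to each proposition symbol. -/
structure Frame (W : Type u) where
  nest : W → Set (Set W)
  nested : ∀ χ, ∀ S ∈ nest χ, ∀ T ∈ nest χ, S ⊆ T ∨ T ⊆ S
  val : ℕ → Set W

/-- A variable assignment. -/
structure Assignment (W : Type u) where
  world : ℕ → W
  nbhd : ℕ → Set W
  nbhd_nonempty : ∀ N, (nbhd N).Nonempty

/-- The templates over a frame: a reference world with a neighbourhood from its system. -/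
structure Template {W : Type u} (F : Frame W) where
  ref : W
  nbhd : Set W
  mem : nbhd ∈ F.nest ref

/-- The structures over a frame at which formulas of a given kind are evaluated:
models (given by their reference world) for `F_n`, templates for `F_w`. -/
abbrev Struc {W : Type u} (F : Frame W) : Kind → Type u
  | .n => W
  | .w => Template F

/-- Satisfaction. A formula labelled by a neighbourhood (world) variable requires that the
denotation of the variable is a neighbourhood of the reference world (a world of the
reference neighbourhood). -/
def Sat {W : Type u} (F : Frame W) (σ : Assignment W) : {s : Kind} → Fml s → Struc F s → Prop
  | _, .atom p, χ => χ ∈ F.val p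
  | _, .incl M, T => σ.nbhd M ∈ F.nest T.ref ∧ σ.nbhd M ⊆ T.nbhd
  | _, .cont M, T => σ.nbhd M ∈ F.nest T.ref ∧ T.nbhd ⊆ σ.nbhd M
  | _, .top, _ => True
  | _, .bot, _ => False
  | _, .neg α, x => ¬ Sat F σ α x
  | _, .and α β, x => Sat F σ α x ∧ Sat F σ β x
  | _, .or α β, x => Sat F σ α x ∨ Sat F σ β x
  | _, .imp α β, x => ¬ Sat F σ α x ∨ Sat F σ β x
  | _, .byN .all α, χ => ∀ (N : Set W) (h : N ∈ F.nest χ), Sat F σ α ⟨χ, N, h⟩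
  | _, .byN .ex α, χ => ∃ (N : Set W) (h : N ∈ F.nest χ), Sat F σ α ⟨χ, N, h⟩
  | _, .byN (.var X) α, χ => ∃ h : σ.nbhd X ∈ F.nest χ, Sat F σ α ⟨χ, σ.nbhd X, h⟩
  | _, .byW .all α, T => ∀ v ∈ T.nbhd, Sat F σ α v
  | _, .byW .ex α, T => ∃ v ∈ T.nbhd, Sat F σ α v
  | _, .byW (.var z) α, T => σ.world z ∈ T.nbhd ∧ Sat F σ α (σ.world z)

/-- Validity: truth under every assignment in every model (for `F_n`), respectively in every
template (for `F_w`); these are the n-tautologies and the w-tautologies. -/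
def Valid {s : Kind} (φ : Fml s) : Prop :=
  ∀ (W : Type u) (F : Frame W) (σ : Assignment W) (x : Struc F s), Sat F σ φ x

/-! ### The natural deduction system PUC-ND -/

/-- Contexts, i.e. stacks of labels. `Ctx s` consists of the contexts `Δ` into which the
formulas of kind `s` fit, that is, for which labelling a formula of kind `s` by the labels of `Δ`
(top of the stack first) yields a formula of `F_n`; see `Ctx.close`.
The last argument of `addN` and `addW` is the top of the stack. -/
inductive Ctx : Kind → Type
  | nil : Ctx .n
  | addN (Δ : Ctx .n) (φ : NLabel) : Ctx .w
  | addW (Δ : Ctx .w) (φ : WLabel) : Ctx .n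

/-- The formula of `F_n` obtained by moving the context into the formula. -/
def Ctx.close : {s : Kind} → Ctx s → Fml s → Fml .n
  | _, .nil, α => α
  | _, .addN Δ φ, α => Δ.close (.byN φ α)
  | _, .addW Δ φ, α => Δ.close (.byW φ α)

/-- The context is empty. -/
def Ctx.IsNil : {s : Kind} → Ctx s → Prop
  | _, .nil => True
  | _, .addN _ _ => False
  | _, .addW _ _ => False

/-- `⊛` occurs in the context. -/
def Ctx.HasNAll : {s : Kind} → Ctx s → Prop
  | _, .nil => False
  | _, .addN Δ φ => φ = .all ∨ Δ.HasNAll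
  | _, .addW Δ _ => Δ.HasNAll

/-- `⊚` occurs in the context. -/
def Ctx.HasNEx : {s : Kind} → Ctx s → Prop
  | _, .nil => False
  | _, .addN Δ φ => φ = .ex ∨ Δ.HasNEx
  | _, .addW Δ _ => Δ.HasNEx

/-- A universal quantifier (`⊛` or `∗`) occurs in the context. -/
def Ctx.HasUniv : {s : Kind} → Ctx s → Prop
  | _, .nil => False
  | _, .addN Δ φ => φ = .all ∨ Δ.HasUniv
  | _, .addW Δ φ => φ = .all ∨ Δ.HasUniv

/-- An existential quantifier (`⊚` or `•`) occurs in the context. -/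
def Ctx.HasExis : {s : Kind} → Ctx s → Prop
  | _, .nil => False
  | _, .addN Δ φ => φ = .ex ∨ Δ.HasExis
  | _, .addW Δ φ => φ = .ex ∨ Δ.HasExis

/-- The neighbourhood variable `N` occurs in the context. -/
def Ctx.OccN (N : ℕ) : {s : Kind} → Ctx s → Prop
  | _, .nil => False
  | _, .addN Δ φ => φ = .var N ∨ Δ.OccN N
  | _, .addW Δ _ => Δ.OccN N

/-- The world variable `z` occurs in the context. -/
def Ctx.OccW (z : ℕ) : {s : Kind} → Ctx s → Prop
  | _, .nil => False
  | _, .addN Δ _ => Δ.OccW z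
  | _, .addW Δ φ => φ = .var z ∨ Δ.OccW z

/-- The neighbourhood variable `N` occurs in the formula. -/
def Fml.OccN (N : ℕ) : {s : Kind} → Fml s → Prop
  | _, .atom _ => False
  | _, .incl M => M = N
  | _, .cont M => M = N
  | _, .top => False
  | _, .bot => False
  | _, .neg α => α.OccN N
  | _, .and α β => α.OccN N ∨ β.OccN N
  | _, .or α β => α.OccN N ∨ β.OccN N
  | _, .imp α β => α.OccN N ∨ β.OccN N
  | _, .byW _ α => α.OccN N
  | _, .byN φ α => φ = .var N ∨ α.OccN N

/-- The world variable `z` occurs in the formula. -/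
def Fml.OccW (z : ℕ) : {s : Kind} → Fml s → Prop
  | _, .atom _ => False
  | _, .incl _ => False
  | _, .cont _ => False
  | _, .top => False
  | _, .bot => False
  | _, .neg α => α.OccW z
  | _, .and α β => α.OccW z ∨ β.OccW z
  | _, .or α β => α.OccW z ∨ β.OccW z
  | _, .imp α β => α.OccW z ∨ β.OccW z
  | _, .byW φ α => φ = .var z ∨ α.OccW z
  | _, .byN _ α => α.OccW z

/-- A hypothesis: a formula placed in a context into which it fits. -/
structure Hyp where
  kind : Kind
  ctx : Ctx kind
  fml : Fml kind

/-- A formula in a context, as a hypothesis. -/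
def hyp {s : Kind} (Δ : Ctx s) (α : Fml s) : Hyp := ⟨s, Δ, α⟩

/-- The neighbourhood variable `N` occurs neither in the hypotheses nor in their contexts. -/
def FreshN (N : ℕ) (H : Set Hyp) : Prop :=
  ∀ h ∈ H, ¬ h.fml.OccN N ∧ ¬ h.ctx.OccN N

/-- The world variable `z` occurs neither in the hypotheses nor in their contexts. -/
def FreshW (z : ℕ) (H : Set Hyp) : Prop :=
  ∀ h ∈ H, ¬ h.fml.OccW z ∧ ¬ h.ctx.OccW z

/-- `Deriv H Δ α`: there is a derivation in PUC-ND with conclusion `α` in the context `Δ` whose set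
of open hypotheses is `H`. The requirement that formulas fit into their contexts is built into
the types. As usual for this system, `¬ α` is interchangeable with `α → ⊥`: the constructors
`neg_intro` and `neg_elim` are implication introduction and elimination for `¬ α` read in this
way. -/
inductive Deriv : Set Hyp → {s : Kind} → Ctx s → Fml s → Prop
  | and_elim_left {s : Kind} {H : Set Hyp} {Δ : Ctx s} {α β : Fml s} :
      ¬ Δ.HasExis → Deriv H Δ (.and α β) → Deriv H Δ α
  | and_elim_right {s : Kind} {H : Set Hyp} {Δ : Ctx s} {α β : Fml s} :
      ¬ Δ.HasExis → Deriv H Δ (.and α β) → Deriv H Δ β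
  | and_intro {s : Kind} {H₁ H₂ : Set Hyp} {Δ : Ctx s} {α β : Fml s} :
      ¬ Δ.HasExis → Deriv H₁ Δ α → Deriv H₂ Δ β → Deriv (H₁ ∪ H₂) Δ (.and α β)
  | or_intro_left {s : Kind} {H : Set Hyp} {Δ : Ctx s} {α β : Fml s} :
      ¬ Δ.HasUniv → Deriv H Δ α → Deriv H Δ (.or α β)
  | or_elim {s t : Kind} {H₁ H₂ H₃ : Set Hyp} {Δ : Ctx s} {α β : Fml s} {Θ : Ctx t} {γ : Fml t} :
      ¬ Δ.HasUniv → Deriv H₁ Δ (.or α β) → Deriv H₂ Θ γ → Deriv H₃ Θ γ →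
      Deriv (H₁ ∪ (H₂ \ {hyp Δ α}) ∪ (H₃ \ {hyp Δ β})) Θ γ
  | or_intro_right {s : Kind} {H : Set Hyp} {Δ : Ctx s} {α β : Fml s} :
      ¬ Δ.HasUniv → Deriv H Δ β → Deriv H Δ (.or α β)
  | bot_classical {s : Kind} {H : Set Hyp} {Δ : Ctx s} {α : Fml s} :
      Deriv H Δ .bot → Deriv (H \ {hyp Δ (.neg α)}) Δ α
  | bot_intuitionistic {s : Kind} {H : Set Hyp} {Δ : Ctx s} {α : Fml s} :
      Deriv H Δ .bot → Deriv H Δ α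
  | absurd_expansion {s : Kind} {H : Set Hyp} {Δ : Ctx s} :
      ¬ Δ.HasNAll → ¬ Δ.IsNil → Deriv H Δ .bot → Deriv H .nil .bot
  | hypothesis_injection {s : Kind} {Δ : Ctx s} {α : Fml s} :
      Deriv {hyp Δ α} Δ α
  | imp_intro {s : Kind} {H : Set Hyp} {Δ : Ctx s} {α β : Fml s} :
      Deriv H Δ β → Deriv (H \ {hyp Δ α}) Δ (.imp α β)
  | neg_intro {s : Kind} {H : Set Hyp} {Δ : Ctx s} {α : Fml s} :
      Deriv H Δ .bot → Deriv (H \ {hyp Δ α}) Δ (.neg α)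
  | imp_elim {s : Kind} {H₁ H₂ : Set Hyp} {Δ : Ctx s} {α β : Fml s} :
      ¬ Δ.HasExis → Deriv H₁ Δ α → Deriv H₂ Δ (.imp α β) → Deriv (H₁ ∪ H₂) Δ β
  | neg_elim {s : Kind} {H₁ H₂ : Set Hyp} {Δ : Ctx s} {α : Fml s} :
      ¬ Δ.HasExis → Deriv H₁ Δ α → Deriv H₂ Δ (.neg α) → Deriv (H₁ ∪ H₂) Δ .bot
  | context_intro_n {H : Set Hyp} {Δ : Ctx .n} {φ : NLabel} {α : Fml .w} :
      Deriv H Δ (.byN φ α) → Deriv H (.addN Δ φ) α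
  | context_intro_w {H : Set Hyp} {Δ : Ctx .w} {φ : WLabel} {α : Fml .n} :
      Deriv H Δ (.byW φ α) → Deriv H (.addW Δ φ) α
  | context_elim_n {H : Set Hyp} {Δ : Ctx .n} {φ : NLabel} {α : Fml .w} :
      Deriv H (.addN Δ φ) α → Deriv H Δ (.byN φ α)
  | context_elim_w {H : Set Hyp} {Δ : Ctx .w} {φ : WLabel} {α : Fml .n} :
      Deriv H (.addW Δ φ) α → Deriv H Δ (.byW φ α)
  | world_univ_intro {H : Set Hyp} {Δ : Ctx .w} {z : ℕ} {α : Fml .n} :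
      FreshW z H → Deriv H (.addW Δ (.var z)) α → Deriv H (.addW Δ .all) α
  | world_univ_elim {H : Set Hyp} {Δ : Ctx .w} {z : ℕ} {α : Fml .n} :
      ¬ α.OccW z → ¬ Δ.OccW z → Deriv H (.addW Δ .all) α → Deriv H (.addW Δ (.var z)) α
  | world_exis_intro {H : Set Hyp} {Δ : Ctx .w} {z : ℕ} {α : Fml .n} :
      Deriv H (.addW Δ (.var z)) α → Deriv H (.addW Δ .ex) α
  | world_exis_elim {t : Kind} {H₁ H₂ : Set Hyp} {Δ : Ctx .w} {z : ℕ} {α : Fml .n}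
      {Θ : Ctx t} {β : Fml t} :
      ¬ α.OccW z → ¬ Δ.OccW z → ¬ Θ.OccW z →
      FreshW z (H₁ ∪ (H₂ \ {hyp (.addW Δ (.var z)) α})) →
      Deriv H₁ (.addW Δ .ex) α → Deriv H₂ Θ β →
      Deriv (H₁ ∪ (H₂ \ {hyp (.addW Δ (.var z)) α})) Θ β
  | nbhd_exis_intro {H₁ H₂ : Set Hyp} {Δ : Ctx .n} {N : ℕ} {α β : Fml .w} :
      Deriv H₁ (.addN Δ (.var N)) α → Deriv H₂ (.addN Δ .ex) β →
      Deriv (H₁ ∪ H₂) (.addN Δ .ex) α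
  | nbhd_exis_elim {t : Kind} {H₁ H₂ : Set Hyp} {Δ : Ctx .n} {N : ℕ} {α : Fml .w}
      {Θ : Ctx t} {β : Fml t} :
      ¬ α.OccN N → ¬ Δ.OccN N → ¬ Θ.OccN N →
      FreshN N (H₁ ∪ (H₂ \ {hyp (.addN Δ (.var N)) α})) →
      Deriv H₁ (.addN Δ .ex) α → Deriv H₂ Θ β →
      Deriv (H₁ ∪ (H₂ \ {hyp (.addN Δ (.var N)) α})) Θ β
  | nbhd_univ_intro {H : Set Hyp} {Δ : Ctx .n} {N : ℕ} {α : Fml .w} :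
      FreshN N H → Deriv H (.addN Δ (.var N)) α → Deriv H (.addN Δ .all) α
  | nbhd_univ_wildcard {H₁ H₂ : Set Hyp} {Δ : Ctx .n} {N : ℕ} {α β : Fml .w} :
      Deriv H₁ (.addN Δ .all) α → Deriv H₂ (.addN Δ (.var N)) β →
      Deriv (H₁ ∪ H₂) (.addN Δ (.var N)) α
  | world_exis_propagation {H₁ H₂ : Set Hyp} {Δ : Ctx .n} {N M : ℕ} {α : Fml .n} :
      Deriv H₁ (.addN Δ (.var N)) (.byW .ex α) → Deriv H₂ (.addN Δ (.var M)) (.incl N) →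
      Deriv (H₁ ∪ H₂) (.addN Δ (.var M)) (.byW .ex α)
  | world_univ_propagation {H₁ H₂ : Set Hyp} {Δ : Ctx .n} {N M : ℕ} {α : Fml .n} :
      Deriv H₁ (.addN Δ (.var N)) (.byW .all α) → Deriv H₂ (.addN Δ (.var M)) (.cont N) →
      Deriv (H₁ ∪ H₂) (.addN Δ (.var M)) (.byW .all α)
  | incl_trans {H₁ H₂ : Set Hyp} {Δ : Ctx .n} {N M P : ℕ} :
      Deriv H₁ (.addN Δ (.var N)) (.incl M) → Deriv H₂ (.addN Δ (.var M)) (.incl P) →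
      Deriv (H₁ ∪ H₂) (.addN Δ (.var N)) (.incl P)
  | cont_trans {H₁ H₂ : Set Hyp} {Δ : Ctx .n} {N M P : ℕ} :
      Deriv H₁ (.addN Δ (.var N)) (.cont M) → Deriv H₂ (.addN Δ (.var M)) (.cont P) →
      Deriv (H₁ ∪ H₂) (.addN Δ (.var N)) (.cont P)
  | total_order_incl {t : Kind} {H₁ H₂ : Set Hyp} {Δ : Ctx .n} {N M : ℕ}
      {Θ : Ctx t} {α : Fml t} :
      Deriv H₁ Θ α → Deriv H₂ Θ α →
      Deriv ((H₁ \ {hyp (.addN Δ (.var N)) (.incl M)}) ∪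
        (H₂ \ {hyp (.addN Δ (.var M)) (.incl N)})) Θ α
  | total_order_cont {t : Kind} {H₁ H₂ : Set Hyp} {Δ : Ctx .n} {N M : ℕ}
      {Θ : Ctx t} {α : Fml t} :
      Deriv H₁ Θ α → Deriv H₂ Θ α →
      Deriv ((H₁ \ {hyp (.addN Δ (.var N)) (.cont M)}) ∪
        (H₂ \ {hyp (.addN Δ (.var M)) (.cont N)})) Θ α
  | total_order_mixed {t : Kind} {H₁ H₂ : Set Hyp} {Δ : Ctx .n} {N M : ℕ}
      {Θ : Ctx t} {α : Fml t} :
      Deriv H₁ Θ α → Deriv H₂ Θ α →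
      Deriv ((H₁ \ {hyp (.addN Δ (.var M)) (.incl N)}) ∪
        (H₂ \ {hyp (.addN Δ (.var M)) (.cont N)})) Θ α
  | truth_acceptance {s : Kind} {Δ : Ctx s} :
      ¬ Δ.HasNEx → Deriv ∅ Δ .top

/-- `φ` is a theorem: it has a derivation in the empty context without open hypotheses. -/
def Provable (φ : Fml .n) : Prop := Deriv ∅ .nil φ

/-- A set of formulas is decidable: the set of Goedel numbers of its members is recursive. -/
def DecidableSet {s : Kind} (P : Fml s → Prop) : Prop :=
  ComputablePred fun k : ℕ => ∃ φ : Fml s, φ.code = k ∧ P φ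

end PUC

/-!
In contexts of variables all labels are interchangeable: implication introduction has no side
condition, so `Δ, ⊚ : ⊤ → ⊤` is derivable and serves as the existential premise of the introduction
rule for `⊚`. Hence derivability only sees the depth at which proposition symbols occur, and a
maximal consistent set argument identifies the theorems with the formulas valid for propositional
valuations whose symbols are indexed by depth. Such validity is validity of a label-free formula.

Validity is decided by the finite model property. Worlds are identified if, for all Goedel numbers
and variable numbers at most `k`, they satisfy the same formulas, are the values of the same world
variables and lie in the values of the same neighbourhood variables.
Doubling every class keeps the inclusions between neighbourhoods and the values of neighbourhood
variables exact, so a formula with Goedel number `k` that is not valid fails in a model with exactly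
`2 * 8 ^ (k + 1)` worlds. These models are coded by numbers, and model checking is a primitive
recursion on Goedel numbers. Finally, `α` in `F_w` is valid if and only if `α^⊛` in `F_n` is.
-/

namespace PUC

/-! ### Soundness and completeness of PUC-ND for propositional valuations -/

/-- Truth of a formula at depth `d` of a propositional valuation `v` in which labels, universal or
not, merely increase the depth at which proposition symbols are read. This is the semantics for
which PUC-ND is sound and complete. -/
def DepthSat (v : ℕ → ℕ → Prop) : {s : Kind} → Fml s → ℕ → Prop
  | _, .atom p, d => v p d
  | _, .incl _, _ => True
  | _, .cont _, _ => True
  | _, .top, _ => True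
  | _, .bot, _ => False
  | _, .neg α, d => ¬ DepthSat v α d
  | _, .and α β, d => DepthSat v α d ∧ DepthSat v β d
  | _, .or α β, d => DepthSat v α d ∨ DepthSat v β d
  | _, .imp α β, d => DepthSat v α d → DepthSat v β d
  | _, .byW _ α, d => DepthSat v α (d + 1)
  | _, .byN _ α, d => DepthSat v α (d + 1)

/-- The number of labels in a context, which is the depth at which its formulas are read. -/
def Ctx.length : {s : Kind} → Ctx s → ℕ
  | _, .nil => 0
  | _, .addN Δ _ => Δ.length + 1
  | _, .addW Δ _ => Δ.length + 1

theorem forall_mem_of_sdiff {ι : Type*} {p : ι → Prop} {H : Set ι} {a : ι} (ha : p a)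
    (h : ∀ k ∈ H \ {a}, p k) : ∀ k ∈ H, p k := fun k hk => by
  by_cases hka : k = a
  · exact hka ▸ ha
  · exact h k ⟨hk, hka⟩

theorem Deriv.depthSat {H : Set Hyp} {s : Kind} {Δ : Ctx s} {α : Fml s} (h : Deriv H Δ α)
    (v : ℕ → ℕ → Prop) (hH : ∀ h ∈ H, DepthSat v h.fml h.ctx.length) : DepthSat v α Δ.length := by
  induction h with
  | hypothesis_injection => exact hH _ rfl
  | incl_trans | cont_trans | truth_acceptance => trivial
  | and_elim_left _ _ ih => exact (ih hH).1
  | and_elim_right _ _ ih => exact (ih hH).2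
  | or_intro_left _ _ ih => exact .inl (ih hH)
  | or_intro_right _ _ ih => exact .inr (ih hH)
  | bot_intuitionistic _ ih => exact (ih hH).elim
  | context_intro_n _ ih | context_intro_w _ ih | context_elim_n _ ih | context_elim_w _ ih
  | world_exis_intro _ ih | world_univ_intro _ _ ih | nbhd_univ_intro _ _ ih
  | world_univ_elim _ _ _ ih | absurd_expansion _ _ _ ih => exact ih hH
  | nbhd_exis_intro _ _ ih _ | nbhd_univ_wildcard _ _ ih _ | world_exis_propagation _ _ ih _
  | world_univ_propagation _ _ ih _ => exact ih fun k hk => hH k (.inl hk)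
  | and_intro _ _ _ ih₁ ih₂ =>
    exact ⟨ih₁ fun k hk => hH k (.inl hk), ih₂ fun k hk => hH k (.inr hk)⟩
  | imp_elim _ _ _ ih₁ ih₂ | neg_elim _ _ _ ih₁ ih₂ =>
    exact (ih₂ fun k hk => hH k (.inr hk)) (ih₁ fun k hk => hH k (.inl hk))
  | imp_intro _ ih | neg_intro _ ih =>
    exact fun hα => ih (forall_mem_of_sdiff (by exact hα) hH)
  | bot_classical _ ih =>
    by_contra hα
    exact ih (forall_mem_of_sdiff (by exact hα) hH)
  | or_elim _ _ _ _ ih₁ ih₂ ih₃ =>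
    rcases ih₁ fun k hk => hH k (.inl (.inl hk)) with hα | hβ
    · exact ih₂ <| forall_mem_of_sdiff (by exact hα) fun k hk => hH k (.inl (.inr hk))
    · exact ih₃ <| forall_mem_of_sdiff (by exact hβ) fun k hk => hH k (.inr hk)
  | world_exis_elim _ _ _ _ _ _ ih₁ ih₂ | nbhd_exis_elim _ _ _ _ _ _ ih₁ ih₂ =>
    have hα := ih₁ fun k hk => hH k (.inl hk)
    exact ih₂ <| forall_mem_of_sdiff (by exact hα) fun k hk => hH k (.inr hk)
  | total_order_incl _ _ ih _ | total_order_cont _ _ ih _ | total_order_mixed _ _ ih _ =>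
    exact ih <| forall_mem_of_sdiff (by trivial) fun k hk => hH k (.inl hk)

theorem Deriv.finite {H : Set Hyp} {s : Kind} {Δ : Ctx s} {α : Fml s} (h : Deriv H Δ α) :
    H.Finite := by
  induction h with
  | hypothesis_injection => exact Set.finite_singleton _
  | truth_acceptance => exact Set.finite_empty
  | bot_classical _ ih | imp_intro _ ih | neg_intro _ ih => exact ih.sdiff
  | or_elim _ _ _ _ h₁ h₂ h₃ => exact (h₁.union h₂.sdiff).union h₃.sdiff
  | world_exis_elim _ _ _ _ _ _ h₁ h₂ | nbhd_exis_elim _ _ _ _ _ _ h₁ h₂ =>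
    exact h₁.union h₂.sdiff
  | total_order_incl _ _ h₁ h₂ | total_order_cont _ _ h₁ h₂ | total_order_mixed _ _ h₁ h₂ =>
    exact h₁.sdiff.union h₂.sdiff
  | _ => first | assumption | exact Set.Finite.union (by assumption) (by assumption)

/-- Derivability of `α` in the context `Δ` from some of the hypotheses in `Γ`. -/
def Entails (Γ : Set Hyp) {s : Kind} (Δ : Ctx s) (α : Fml s) : Prop :=
  ∃ H ⊆ Γ, Deriv H Δ α

/-- All labels in the context are variables. In such contexts all rules for the connectives
apply. -/
def Ctx.VarOnly {s : Kind} (Δ : Ctx s) : Prop :=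
  ¬ Δ.HasExis ∧ ¬ Δ.HasUniv

namespace Ctx

theorem not_hasNAll : {s : Kind} → {Δ : Ctx s} → ¬ Δ.HasUniv → ¬ Δ.HasNAll
  | _, .nil, _ => id
  | _, .addN _ _, h => fun k => h (k.imp_right (not_imp_not.1 not_hasNAll))
  | _, .addW _ _, h => fun k => h (.inr (not_imp_not.1 not_hasNAll k))

theorem not_hasNEx : {s : Kind} → {Δ : Ctx s} → ¬ Δ.HasExis → ¬ Δ.HasNEx
  | _, .nil, _ => id
  | _, .addN _ _, h => fun k => h (k.imp_right (not_imp_not.1 not_hasNEx))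
  | _, .addW _ _, h => fun k => h (.inr (not_imp_not.1 not_hasNEx k))

theorem varOnly_nil : Ctx.nil.VarOnly := ⟨id, id⟩

theorem VarOnly.addN {Δ : Ctx .n} (h : Δ.VarOnly) (N : ℕ) : (Δ.addN (.var N)).VarOnly := by
  simpa [VarOnly, HasExis, HasUniv] using h

theorem VarOnly.addW {Δ : Ctx .w} (h : Δ.VarOnly) (z : ℕ) : (Δ.addW (.var z)).VarOnly := by
  simpa [VarOnly, HasExis, HasUniv] using h

theorem VarOnly.of_addN {Δ : Ctx .n} {φ : NLabel} (h : (Δ.addN φ).VarOnly) : Δ.VarOnly :=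
  ⟨mt .inr h.1, mt .inr h.2⟩

theorem VarOnly.of_addW {Δ : Ctx .w} {φ : WLabel} (h : (Δ.addW φ).VarOnly) : Δ.VarOnly :=
  ⟨mt .inr h.1, mt .inr h.2⟩

theorem occN_close {N : ℕ} : {s : Kind} → {Δ : Ctx s} → {α : Fml s} →
    ((Δ.close α).OccN N ↔ Δ.OccN N ∨ α.OccN N)
  | _, .nil, _ => by simp only [close, OccN, false_or]
  | _, .addN Δ _, _ => (occN_close (Δ := Δ)).trans (by simp only [OccN, Fml.OccN]; tauto)
  | _, .addW Δ _, _ => (occN_close (Δ := Δ)).trans (by simp only [OccN, Fml.OccN])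

theorem occW_close {z : ℕ} : {s : Kind} → {Δ : Ctx s} → {α : Fml s} →
    ((Δ.close α).OccW z ↔ Δ.OccW z ∨ α.OccW z)
  | _, .nil, _ => by simp only [close, OccW, false_or]
  | _, .addN Δ _, _ => (occW_close (Δ := Δ)).trans (by simp only [OccW, Fml.OccW])
  | _, .addW Δ _, _ => (occW_close (Δ := Δ)).trans (by simp only [OccW, Fml.OccW]; tauto)

end Ctx

theorem Fml.le_code_of_occN {N : ℕ} {s : Kind} {α : Fml s} (h : α.OccN N) : N ≤ α.code := by
  induction α with
  | atom | top | bot => exact h.elim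
  | incl M | cont M => exact h.symm.le.trans (Nat.right_le_pair _ _)
  | neg α ih => exact (ih h).trans (Nat.right_le_pair _ _)
  | and α β ih₁ ih₂ | or α β ih₁ ih₂ | imp α β ih₁ ih₂ =>
    refine le_trans ?_ (Nat.right_le_pair _ _)
    exact h.elim (fun h => (ih₁ h).trans (Nat.left_le_pair _ _))
      fun h => (ih₂ h).trans (Nat.right_le_pair _ _)
  | byW φ α ih => exact ((ih h).trans (Nat.right_le_pair _ _)).trans (Nat.right_le_pair _ _)
  | byN φ α ih =>
    refine le_trans ?_ (Nat.right_le_pair _ _)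
    rcases h with rfl | h
    · exact (Nat.le_add_right N 2).trans (Nat.left_le_pair _ _)
    · exact (ih h).trans (Nat.right_le_pair _ _)

theorem Fml.le_code_of_occW {z : ℕ} {s : Kind} {α : Fml s} (h : α.OccW z) : z ≤ α.code := by
  induction α with
  | atom | incl | cont | top | bot => exact h.elim
  | neg α ih => exact (ih h).trans (Nat.right_le_pair _ _)
  | and α β ih₁ ih₂ | or α β ih₁ ih₂ | imp α β ih₁ ih₂ =>
    refine le_trans ?_ (Nat.right_le_pair _ _)
    exact h.elim (fun h => (ih₁ h).trans (Nat.left_le_pair _ _))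
      fun h => (ih₂ h).trans (Nat.right_le_pair _ _)
  | byN φ α ih => exact ((ih h).trans (Nat.right_le_pair _ _)).trans (Nat.right_le_pair _ _)
  | byW φ α ih =>
    refine le_trans ?_ (Nat.right_le_pair _ _)
    rcases h with rfl | h
    · exact (Nat.le_add_right z 2).trans (Nat.left_le_pair _ _)
    · exact (ih h).trans (Nat.right_le_pair _ _)

theorem Ctx.exists_freshN {s : Kind} (Δ : Ctx s) (α : Fml s) : ∃ N, ¬ Δ.OccN N ∧ ¬ α.OccN N := by
  refine ⟨(Δ.close α).code + 1, not_or.1 fun h => ?_⟩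
  exact Nat.not_succ_le_self _ (Fml.le_code_of_occN (occN_close.2 h))

theorem Ctx.exists_freshW {s : Kind} (Δ : Ctx s) (α : Fml s) : ∃ z, ¬ Δ.OccW z ∧ ¬ α.OccW z := by
  refine ⟨(Δ.close α).code + 1, not_or.1 fun h => ?_⟩
  exact Nat.not_succ_le_self _ (Fml.le_code_of_occW (occW_close.2 h))

namespace Entails

section Connectives

variable {s t : Kind} {Γ Γ' : Set Hyp} {Δ : Ctx s} {Θ : Ctx t} {α β : Fml s} {γ : Fml t}

theorem mono (h : Entails Γ Δ α) (hΓ : Γ ⊆ Γ') : Entails Γ' Δ α :=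
  let ⟨H, hH, d⟩ := h
  ⟨H, hH.trans hΓ, d⟩

theorem weaken (h : Entails Γ Δ α) (k : Hyp) : Entails (insert k Γ) Δ α :=
  h.mono (Set.subset_insert _ _)

theorem of_mem (h : hyp Δ α ∈ Γ) : Entails Γ Δ α :=
  ⟨_, Set.singleton_subset_iff.2 h, .hypothesis_injection⟩

theorem insert_self : Entails (insert (hyp Δ α) Γ) Δ α :=
  of_mem (Set.mem_insert _ _)

theorem bot_elim (h : Entails Γ Δ .bot) (α : Fml s) : Entails Γ Δ α :=
  let ⟨H, hH, d⟩ := h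
  ⟨H, hH, .bot_intuitionistic d⟩

theorem by_contra (h : Entails (insert (hyp Δ (.neg α)) Γ) Δ .bot) : Entails Γ Δ α :=
  let ⟨_, hH, d⟩ := h
  ⟨_, Set.sdiff_singleton_subset_iff.2 hH, .bot_classical d⟩

theorem imp_intro (h : Entails (insert (hyp Δ α) Γ) Δ β) : Entails Γ Δ (.imp α β) :=
  let ⟨_, hH, d⟩ := h
  ⟨_, Set.sdiff_singleton_subset_iff.2 hH, .imp_intro d⟩

theorem neg_intro (h : Entails (insert (hyp Δ α) Γ) Δ .bot) : Entails Γ Δ (.neg α) :=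
  let ⟨_, hH, d⟩ := h
  ⟨_, Set.sdiff_singleton_subset_iff.2 hH, .neg_intro d⟩

theorem top_intro (hΔ : Δ.VarOnly) : Entails Γ Δ .top :=
  ⟨_, Set.empty_subset _, .truth_acceptance (Ctx.not_hasNEx hΔ.1)⟩

theorem and_intro (hΔ : Δ.VarOnly) (h₁ : Entails Γ Δ α) (h₂ : Entails Γ Δ β) :
    Entails Γ Δ (.and α β) :=
  let ⟨_, hH₁, d₁⟩ := h₁
  let ⟨_, hH₂, d₂⟩ := h₂
  ⟨_, Set.union_subset hH₁ hH₂, .and_intro hΔ.1 d₁ d₂⟩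

theorem and_left (hΔ : Δ.VarOnly) (h : Entails Γ Δ (.and α β)) : Entails Γ Δ α :=
  let ⟨_, hH, d⟩ := h
  ⟨_, hH, .and_elim_left hΔ.1 d⟩

theorem and_right (hΔ : Δ.VarOnly) (h : Entails Γ Δ (.and α β)) : Entails Γ Δ β :=
  let ⟨_, hH, d⟩ := h
  ⟨_, hH, .and_elim_right hΔ.1 d⟩

theorem or_inl (hΔ : Δ.VarOnly) (h : Entails Γ Δ α) : Entails Γ Δ (.or α β) :=
  let ⟨_, hH, d⟩ := h
  ⟨_, hH, .or_intro_left hΔ.2 d⟩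

theorem or_inr (hΔ : Δ.VarOnly) (h : Entails Γ Δ β) : Entails Γ Δ (.or α β) :=
  let ⟨_, hH, d⟩ := h
  ⟨_, hH, .or_intro_right hΔ.2 d⟩

theorem or_elim (hΔ : Δ.VarOnly) (h : Entails Γ Δ (.or α β))
    (h₁ : Entails (insert (hyp Δ α) Γ) Θ γ) (h₂ : Entails (insert (hyp Δ β) Γ) Θ γ) :
    Entails Γ Θ γ :=
  let ⟨_, hH, d⟩ := h
  let ⟨_, hH₁, d₁⟩ := h₁
  let ⟨_, hH₂, d₂⟩ := h₂
  ⟨_, Set.union_subset (Set.union_subset hH (Set.sdiff_singleton_subset_iff.2 hH₁))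
    (Set.sdiff_singleton_subset_iff.2 hH₂), .or_elim hΔ.2 d d₁ d₂⟩

theorem mp (hΔ : Δ.VarOnly) (h₁ : Entails Γ Δ (.imp α β)) (h₂ : Entails Γ Δ α) : Entails Γ Δ β :=
  let ⟨_, hH₁, d₁⟩ := h₁
  let ⟨_, hH₂, d₂⟩ := h₂
  ⟨_, Set.union_subset hH₂ hH₁, .imp_elim hΔ.1 d₂ d₁⟩

theorem neg_elim (hΔ : Δ.VarOnly) (h₁ : Entails Γ Δ (.neg α)) (h₂ : Entails Γ Δ α) :
    Entails Γ Δ .bot :=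
  let ⟨_, hH₁, d₁⟩ := h₁
  let ⟨_, hH₂, d₂⟩ := h₂
  ⟨_, Set.union_subset hH₂ hH₁, .neg_elim hΔ.1 d₂ d₁⟩

theorem nil_bot : {s : Kind} → {Δ : Ctx s} → Δ.VarOnly → Entails Γ Δ .bot → Entails Γ .nil .bot
  | _, .nil, _, h => h
  | _, .addN _ _, hΔ, ⟨H, hH, d⟩ => ⟨H, hH, .absurd_expansion (Ctx.not_hasNAll hΔ.2) id d⟩
  | _, .addW _ _, hΔ, ⟨H, hH, d⟩ => ⟨H, hH, .absurd_expansion (Ctx.not_hasNAll hΔ.2) id d⟩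

theorem nil_bot_of_neg (hΔ : Δ.VarOnly) (h₁ : Entails Γ Δ (.neg α)) (h₂ : Entails Γ Δ α) :
    Entails Γ .nil .bot :=
  (h₁.neg_elim hΔ h₂).nil_bot hΔ

theorem byN_iff {Δ : Ctx .n} {φ : NLabel} {α : Fml .w} :
    Entails Γ Δ (.byN φ α) ↔ Entails Γ (Δ.addN φ) α :=
  ⟨fun ⟨H, hH, d⟩ => ⟨H, hH, .context_intro_n d⟩, fun ⟨H, hH, d⟩ => ⟨H, hH, .context_elim_n d⟩⟩

theorem byW_iff {Δ : Ctx .w} {φ : WLabel} {α : Fml .n} :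
    Entails Γ Δ (.byW φ α) ↔ Entails Γ (Δ.addW φ) α :=
  ⟨fun ⟨H, hH, d⟩ => ⟨H, hH, .context_intro_w d⟩, fun ⟨H, hH, d⟩ => ⟨H, hH, .context_elim_w d⟩⟩

theorem close_iff : {s : Kind} → {Δ : Ctx s} → {α : Fml s} →
    (Entails Γ .nil (Δ.close α) ↔ Entails Γ Δ α)
  | _, .nil, _ => Iff.rfl
  | _, .addN Δ _, _ => (close_iff (Δ := Δ)).trans byN_iff
  | _, .addW Δ _, _ => (close_iff (Δ := Δ)).trans byW_iff

theorem of_nil_bot (h : Entails Γ .nil .bot) : Entails Γ Δ α :=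
  close_iff.1 (h.bot_elim _)

theorem cut (h₁ : Entails Γ Δ α) (h₂ : Entails (insert (hyp .nil (Δ.close α)) Γ) Θ γ) :
    Entails Γ Θ γ :=
  close_iff.1 (mp Ctx.varOnly_nil (close_iff.2 h₂).imp_intro (close_iff.2 h₁))

end Connectives

/-! ### All labels are interchangeable in variable contexts -/

section Labels

variable {Γ : Set Hyp}

theorem nbhd_exis_elim {Δ : Ctx .n} {α : Fml .w} {t : Kind} {Θ : Ctx t} {γ : Fml t} {N : ℕ}
    (hα : ¬ α.OccN N) (hΔ : ¬ Δ.OccN N) (hΘ : ¬ Θ.OccN N) (hΓ : FreshN N Γ)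
    (h : Entails Γ (Δ.addN .ex) α) (h' : Entails (insert (hyp (Δ.addN (.var N)) α) Γ) Θ γ) :
    Entails Γ Θ γ := by
  obtain ⟨H, hH, d⟩ := h
  obtain ⟨H', hH', d'⟩ := h'
  have hsub := Set.union_subset hH (Set.sdiff_singleton_subset_iff.2 hH')
  exact ⟨_, hsub, .nbhd_exis_elim hα hΔ hΘ (fun k hk => hΓ k (hsub hk)) d d'⟩

theorem world_exis_elim {Δ : Ctx .w} {α : Fml .n} {t : Kind} {Θ : Ctx t} {γ : Fml t} {z : ℕ}
    (hα : ¬ α.OccW z) (hΔ : ¬ Δ.OccW z) (hΘ : ¬ Θ.OccW z) (hΓ : FreshW z Γ)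
    (h : Entails Γ (Δ.addW .ex) α) (h' : Entails (insert (hyp (Δ.addW (.var z)) α) Γ) Θ γ) :
    Entails Γ Θ γ := by
  obtain ⟨H, hH, d⟩ := h
  obtain ⟨H', hH', d'⟩ := h'
  have hsub := Set.union_subset hH (Set.sdiff_singleton_subset_iff.2 hH')
  exact ⟨_, hsub, .world_exis_elim hα hΔ hΘ (fun k hk => hΓ k (hsub hk)) d d'⟩

theorem nbhd_var_of_all {Δ : Ctx .n} {α : Fml .w} (hΔ : Δ.VarOnly)
    (h : Entails Γ (Δ.addN .all) α) (N : ℕ) : Entails Γ (Δ.addN (.var N)) α :=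
  let ⟨_, hH, d⟩ := h
  let ⟨_, hH₂, d₂⟩ := top_intro (Γ := Γ) (hΔ.addN N)
  ⟨_, Set.union_subset hH hH₂, .nbhd_univ_wildcard d d₂⟩

-- Implication introduction has no side condition, so `Δ, ⊚ : ⊤ → ⊤` is derivable although it
-- asserts the existence of a neighbourhood; it is the second premise of the introduction rule.
theorem nbhd_ex_of_var {Δ : Ctx .n} {α : Fml .w} {N : ℕ} (h : Entails Γ (Δ.addN (.var N)) α) :
    Entails Γ (Δ.addN .ex) α :=
  let ⟨_, hH, d⟩ := h
  let ⟨_, hH₂, d₂⟩ : Entails Γ (Δ.addN .ex) (.imp .top .top) := insert_self.imp_intro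
  ⟨_, Set.union_subset hH hH₂, .nbhd_exis_intro d d₂⟩

-- If `Δ, ⊛ : α` failed, a witness `N` of `Δ, ⊚ : α` would contradict `Δ, N : ¬ α`, which follows
-- from `Δ, ⊛ : ¬ α`. The cut leaves a single hypothesis, so that `N` can be chosen fresh.
theorem nbhd_all_of_ex {Δ : Ctx .n} {α : Fml .w} (hΔ : Δ.VarOnly)
    (h : Entails Γ (Δ.addN .ex) α) : Entails Γ (Δ.addN .all) α := by
  refine h.cut (mono (Γ := {hyp .nil ((Δ.addN .ex).close α)}) ?_ (by simp))
  obtain ⟨N, hNΔ, hNα⟩ := Δ.exists_freshN (.byN .ex α)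
  rw [Fml.OccN, not_or] at hNα
  refine by_contra (of_nil_bot (nbhd_exis_elim (N := N) hNα.2 hNΔ id ?_
    (close_iff.1 (of_mem (.inr rfl))) ?_))
  · rintro _ (rfl | rfl)
    · exact ⟨hNα.2, by simp [hyp, Ctx.OccN, hNΔ]⟩
    · exact ⟨by simp [hyp, Ctx.occN_close, Ctx.OccN, hNΔ, hNα.2], id⟩
  · exact nil_bot_of_neg (hΔ.addN N) ((insert_self.weaken _).nbhd_var_of_all hΔ N) insert_self

theorem nbhd_label_congr {Δ : Ctx .n} {α : Fml .w} (hΔ : Δ.VarOnly) {φ ψ : NLabel}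
    (h : Entails Γ (Δ.addN φ) α) : Entails Γ (Δ.addN ψ) α := by
  have h_all : Entails Γ (Δ.addN .all) α := by
    cases φ with
    | all => exact h
    | ex => exact h.nbhd_all_of_ex hΔ
    | var N => exact h.nbhd_ex_of_var.nbhd_all_of_ex hΔ
  cases ψ with
  | all => exact h_all
  | ex => exact (h_all.nbhd_var_of_all hΔ 0).nbhd_ex_of_var
  | var N => exact h_all.nbhd_var_of_all hΔ N

theorem world_ex_of_var {Δ : Ctx .w} {α : Fml .n} {z : ℕ} (h : Entails Γ (Δ.addW (.var z)) α) :
    Entails Γ (Δ.addW .ex) α :=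
  let ⟨_, hH, d⟩ := h
  ⟨_, hH, .world_exis_intro d⟩

theorem world_var_of_all_of_fresh {Δ : Ctx .w} {α : Fml .n} {z : ℕ} (hα : ¬ α.OccW z)
    (hΔ : ¬ Δ.OccW z) (h : Entails Γ (Δ.addW .all) α) : Entails Γ (Δ.addW (.var z)) α :=
  let ⟨_, hH, d⟩ := h
  ⟨_, hH, .world_univ_elim hα hΔ d⟩

theorem world_all_of_ex {Δ : Ctx .w} {α : Fml .n} (hΔ : Δ.VarOnly)
    (h : Entails Γ (Δ.addW .ex) α) : Entails Γ (Δ.addW .all) α := by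
  refine h.cut (mono (Γ := {hyp .nil ((Δ.addW .ex).close α)}) ?_ (by simp))
  obtain ⟨z, hzΔ, hzα⟩ := Δ.exists_freshW (.byW .ex α)
  rw [Fml.OccW, not_or] at hzα
  refine by_contra (of_nil_bot (world_exis_elim (z := z) hzα.2 hzΔ id ?_
    (close_iff.1 (of_mem (.inr rfl))) ?_))
  · rintro _ (rfl | rfl)
    · exact ⟨hzα.2, by simp [hyp, Ctx.OccW, hzΔ]⟩
    · exact ⟨by simp [hyp, Ctx.occW_close, Ctx.OccW, hzΔ, hzα.2], id⟩
  · exact nil_bot_of_neg (hΔ.addW z)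
      ((insert_self.weaken _).world_var_of_all_of_fresh (α := .neg α) hzα.2 hzΔ) insert_self

-- If `Δ, z : ¬ α`, then `¬ α` holds under every world label, in particular under a fresh variable.
theorem world_var_of_all {Δ : Ctx .w} {α : Fml .n} (hΔ : Δ.VarOnly)
    (h : Entails Γ (Δ.addW .all) α) (z : ℕ) : Entails Γ (Δ.addW (.var z)) α := by
  obtain ⟨y, hyΔ, hyα⟩ := Δ.exists_freshW (.byW .ex α)
  rw [Fml.OccW, not_or] at hyα
  refine by_contra (of_nil_bot (nil_bot_of_neg (hΔ.addW y) ?_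
    ((h.weaken _).world_var_of_all_of_fresh hyα.2 hyΔ)))
  exact (insert_self.world_ex_of_var.world_all_of_ex hΔ).world_var_of_all_of_fresh
    (α := .neg α) hyα.2 hyΔ

theorem world_label_congr {Δ : Ctx .w} {α : Fml .n} (hΔ : Δ.VarOnly) {φ ψ : WLabel}
    (h : Entails Γ (Δ.addW φ) α) : Entails Γ (Δ.addW ψ) α := by
  have h_all : Entails Γ (Δ.addW .all) α := by
    cases φ with
    | all => exact h
    | ex => exact h.world_all_of_ex hΔ
    | var z => exact h.world_ex_of_var.world_all_of_ex hΔ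
  cases ψ with
  | all => exact h_all
  | ex => exact (h_all.world_var_of_all hΔ 0).world_ex_of_var
  | var z => exact h_all.world_var_of_all hΔ z

theorem varOnly_congr : {s : Kind} → {Δ Δ' : Ctx s} → {α : Fml s} → Δ.VarOnly → Δ'.VarOnly →
    Δ.length = Δ'.length → Entails Γ Δ α → Entails Γ Δ' α
  | _, .nil, .nil, _, _, _, _, h => h
  | _, .addN _ _, .addN _ _, _, hΔ, hΔ', hl, h =>
    byN_iff.1 (varOnly_congr hΔ.of_addN hΔ'.of_addN (Nat.succ_injective hl)
      (byN_iff.2 (h.nbhd_label_congr hΔ.of_addN)))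
  | _, .addW _ _, .addW _ _, _, hΔ, hΔ', hl, h =>
    byW_iff.1 (varOnly_congr hΔ.of_addW hΔ'.of_addW (Nat.succ_injective hl)
      (byW_iff.2 (h.world_label_congr hΔ.of_addW)))
  | _, .nil, .addW _ _, _, _, _, hl, _ => absurd hl (Nat.succ_ne_zero _).symm
  | _, .addW _ _, .nil, _, _, _, hl, _ => absurd hl (Nat.succ_ne_zero _)

-- The rule of total order applied to `M` and `M` proves `Δ, M : ↑M` without hypotheses.
theorem incl_intro {Δ : Ctx .n} (hΔ : Δ.VarOnly) (φ : NLabel) (M : ℕ) :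
    Entails Γ (Δ.addN φ) (.incl M) := by
  refine nbhd_label_congr hΔ (φ := .var M) ⟨∅, Set.empty_subset _, ?_⟩
  simpa [hyp] using Deriv.total_order_incl (Δ := Δ) (N := M) (M := M)
    (Deriv.hypothesis_injection (Δ := Δ.addN (.var M)) (α := .incl M)) .hypothesis_injection

theorem cont_intro {Δ : Ctx .n} (hΔ : Δ.VarOnly) (φ : NLabel) (M : ℕ) :
    Entails Γ (Δ.addN φ) (.cont M) := by
  refine nbhd_label_congr hΔ (φ := .var M) ⟨∅, Set.empty_subset _, ?_⟩
  simpa [hyp] using Deriv.total_order_cont (Δ := Δ) (N := M) (M := M)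
    (Deriv.hypothesis_injection (Δ := Δ.addN (.var M)) (α := .cont M)) .hypothesis_injection

end Labels

end Entails

/-- A maximal set of hypotheses from which `⊥` is not derivable in the empty context. -/
def MaximalConsistent (Γ : Set Hyp) : Prop :=
  Maximal (fun Γ => ¬ Entails Γ .nil .bot) Γ

theorem exists_maximalConsistent {Γ₀ : Set Hyp} (h₀ : ¬ Entails Γ₀ .nil .bot) :
    ∃ Γ, Γ₀ ⊆ Γ ∧ MaximalConsistent Γ := by
  refine zorn_subset_nonempty {Γ : Set Hyp | ¬ Entails Γ .nil .bot} (fun c hc hchain hne => ?_)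
    Γ₀ h₀
  refine ⟨⋃₀ c, ?_, fun s hs => Set.subset_sUnion_of_mem hs⟩
  rintro ⟨H, hH, d⟩
  obtain ⟨T, hT, hHT⟩ := DirectedOn.exists_mem_subset_of_finite_of_subset_sUnion hne
    hchain.directedOn d.finite hH
  exact hc hT ⟨H, hHT, d⟩

namespace MaximalConsistent

variable {Γ : Set Hyp} {s : Kind} {Δ : Ctx s} {α β : Fml s}

theorem entails_nil_bot_of_not (hΓ : MaximalConsistent Γ) (h : ¬ Entails Γ Δ α) :
    Entails (insert (hyp Δ α) Γ) .nil .bot := by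
  by_contra hn
  exact h (.of_mem (hΓ.le_of_ge hn (Set.subset_insert _ _) (Set.mem_insert _ _)))

theorem entails_neg_of_not (hΓ : MaximalConsistent Γ) (h : ¬ Entails Γ Δ α) :
    Entails Γ Δ (.neg α) :=
  .neg_intro (.of_nil_bot (hΓ.entails_nil_bot_of_not h))

theorem entails_neg_iff (hΓ : MaximalConsistent Γ) (hΔ : Δ.VarOnly) :
    Entails Γ Δ (.neg α) ↔ ¬ Entails Γ Δ α :=
  ⟨fun h h' => hΓ.prop (h.nil_bot_of_neg hΔ h'), hΓ.entails_neg_of_not⟩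

theorem entails_or_iff (hΓ : MaximalConsistent Γ) (hΔ : Δ.VarOnly) :
    Entails Γ Δ (.or α β) ↔ Entails Γ Δ α ∨ Entails Γ Δ β := by
  refine ⟨fun h => ?_, fun h => h.elim (.or_inl hΔ) (.or_inr hΔ)⟩
  by_contra! hn
  exact hΓ.prop (h.or_elim hΔ (hΓ.entails_nil_bot_of_not hn.1) (hΓ.entails_nil_bot_of_not hn.2))

theorem entails_imp_iff (hΓ : MaximalConsistent Γ) (hΔ : Δ.VarOnly) :
    Entails Γ Δ (.imp α β) ↔ (Entails Γ Δ α → Entails Γ Δ β) := by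
  refine ⟨fun h => h.mp hΔ, fun h => .imp_intro ?_⟩
  by_cases hα : Entails Γ Δ α
  · exact (h hα).weaken _
  · exact .of_nil_bot (hΓ.entails_nil_bot_of_not hα)

theorem depthSat_iff (hΓ : MaximalConsistent Γ) {s : Kind} (α : Fml s) (Δ : Ctx s)
    (hΔ : Δ.VarOnly) :
    DepthSat (fun p d => ∃ Θ : Ctx .n, Θ.VarOnly ∧ Θ.length = d ∧ Entails Γ Θ (.atom p))
      α Δ.length ↔ Entails Γ Δ α := by
  induction α with
  | atom p =>
    exact ⟨fun ⟨Θ, hΘ, hl, h⟩ => h.varOnly_congr hΘ hΔ hl, fun h => ⟨Δ, hΔ, rfl, h⟩⟩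
  | incl M =>
    cases Δ with
    | addN Δ φ => exact iff_of_true trivial (.incl_intro hΔ.of_addN φ M)
  | cont M =>
    cases Δ with
    | addN Δ φ => exact iff_of_true trivial (.cont_intro hΔ.of_addN φ M)
  | top => exact iff_of_true trivial (.top_intro hΔ)
  | bot => exact iff_of_false id fun h => hΓ.prop (h.nil_bot hΔ)
  | neg α ih => exact (not_congr (ih Δ hΔ)).trans (hΓ.entails_neg_iff hΔ).symm
  | and α β ih₁ ih₂ =>
    exact (and_congr (ih₁ Δ hΔ) (ih₂ Δ hΔ)).trans
      ⟨fun h => .and_intro hΔ h.1 h.2, fun h => ⟨h.and_left hΔ, h.and_right hΔ⟩⟩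
  | or α β ih₁ ih₂ => exact (or_congr (ih₁ Δ hΔ) (ih₂ Δ hΔ)).trans (hΓ.entails_or_iff hΔ).symm
  | imp α β ih₁ ih₂ =>
    exact (imp_congr (ih₁ Δ hΔ) (ih₂ Δ hΔ)).trans (hΓ.entails_imp_iff hΔ).symm
  | byW φ α ih =>
    refine (ih (Δ.addW (.var 0)) (hΔ.addW 0)).trans (Iff.trans ?_ Entails.byW_iff.symm)
    exact ⟨.world_label_congr hΔ, .world_label_congr hΔ⟩
  | byN φ α ih =>
    refine (ih (Δ.addN (.var 0)) (hΔ.addN 0)).trans (Iff.trans ?_ Entails.byN_iff.symm)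
    exact ⟨.nbhd_label_congr hΔ, .nbhd_label_congr hΔ⟩

end MaximalConsistent

theorem provable_iff_entails_empty {φ : Fml .n} : Provable φ ↔ Entails ∅ .nil φ :=
  ⟨fun h => ⟨∅, subset_rfl, h⟩, fun ⟨_, hH, h⟩ => by rwa [Set.subset_empty_iff.1 hH] at h⟩

theorem provable_iff_depthSat {φ : Fml .n} : Provable φ ↔ ∀ v, DepthSat v φ 0 := by
  refine ⟨fun h v => h.depthSat v (by simp), fun h => provable_iff_entails_empty.2 ?_⟩
  by_contra hn
  obtain ⟨Γ, hΓ₀, hΓ⟩ := exists_maximalConsistent (mt Entails.by_contra hn)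
  exact (hΓ.entails_neg_iff Ctx.varOnly_nil).1 (.of_mem (hΓ₀ (Set.mem_insert _ _)))
    ((hΓ.depthSat_iff φ .nil Ctx.varOnly_nil).1 (h _))

/-! ### Reduction of derivability to validity -/

/-- The label-free formula obtained by erasing all labels and replacing each proposition symbol `p`
at depth `d'` of the formula by the symbol with number `Nat.pair (d + d') p`, so that derivability
of `α` becomes validity of `α.flatten 0`. -/
def Fml.flatten (d : ℕ) : {s : Kind} → Fml s → Fml .n
  | _, .atom p => .atom (Nat.pair d p)
  | _, .incl _ => .top
  | _, .cont _ => .top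
  | _, .top => .top
  | _, .bot => .bot
  | _, .neg α => .neg (α.flatten d)
  | _, .and α β => .and (α.flatten d) (β.flatten d)
  | _, .or α β => .or (α.flatten d) (β.flatten d)
  | _, .imp α β => .imp (α.flatten d) (β.flatten d)
  | _, .byW _ α => α.flatten (d + 1)
  | _, .byN _ α => α.flatten (d + 1)

theorem sat_flatten {W : Type u} (F : Frame W) (σ : Assignment W) (χ : W) {s : Kind} (α : Fml s)
    (d : ℕ) :
    Sat F σ (α.flatten d) χ ↔ DepthSat (fun p d => χ ∈ F.val (Nat.pair d p)) α d := by
  induction α generalizing d with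
  | atom | incl | cont | top | bot => exact Iff.rfl
  | neg α ih => exact not_congr (ih d)
  | and α β ih₁ ih₂ => exact and_congr (ih₁ d) (ih₂ d)
  | or α β ih₁ ih₂ => exact or_congr (ih₁ d) (ih₂ d)
  | imp α β ih₁ ih₂ => exact (or_congr (not_congr (ih₁ d)) (ih₂ d)).trans imp_iff_not_or.symm
  | byW _ _ ih | byN _ _ ih => exact ih (d + 1)

theorem provable_iff_valid_flatten {φ : Fml .n} : Provable φ ↔ Valid.{u} (φ.flatten 0) := by
  refine provable_iff_depthSat.trans
    ⟨fun h W F σ χ => (sat_flatten F σ χ φ 0).2 (h _), fun h v => ?_⟩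
  let F : Frame PUnit.{u + 1} := ⟨fun _ => ∅, by simp, fun q => {_χ | v q.unpair.2 q.unpair.1}⟩
  let σ : Assignment PUnit.{u + 1} := ⟨fun _ => .unit, fun _ => Set.univ, by simp⟩
  simpa [F] using (sat_flatten F σ .unit φ 0).1 (h _ F σ .unit)

theorem valid_byN_all_iff {φ : Fml .w} : Valid.{u} (.byN .all φ) ↔ Valid.{u} φ :=
  ⟨fun h W F σ T => h W F σ T.ref T.nbhd T.mem, fun h W F σ _ _ _ => h W F σ ⟨_, _, _⟩⟩

/-! ### Primitive recursion on Goedel numbers -/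

/-- The data for a recursion on formulas with values in `σ`. Labels are given by their Goedel
numbers, and the kinds of the formulas are ignored. The value `junk` is for numbers that are not
Goedel numbers. -/
structure FmlAlgebra (σ : Type*) where
  junk : σ
  atom : ℕ → σ
  incl : ℕ → σ
  cont : ℕ → σ
  top : σ
  bot : σ
  neg : σ → σ
  and : σ → σ → σ
  or : σ → σ → σ
  imp : σ → σ → σ
  byW : ℕ → σ → σ
  byN : ℕ → σ → σ

namespace FmlAlgebra

section Fold

variable {σ : Type*} (A : FmlAlgebra σ)

/-- The value of a formula in an algebra. -/
def eval : {s : Kind} → Fml s → σ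
  | _, .atom p => A.atom p
  | _, .incl N => A.incl N
  | _, .cont N => A.cont N
  | _, .top => A.top
  | _, .bot => A.bot
  | _, .neg α => A.neg (eval α)
  | _, .and α β => A.and (eval α) (eval β)
  | _, .or α β => A.or (eval α) (eval β)
  | _, .imp α β => A.imp (eval α) (eval β)
  | _, .byW φ α => A.byW φ.code (eval α)
  | _, .byN φ α => A.byN φ.code (eval α)

/-- The value at `Nat.pair t m`, given the values `r` at smaller numbers: the table lists the
constructors of formulas by their tags `t` in Goedel numbers. -/
def step (t m : ℕ) (r : ℕ → σ) : σ :=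
  [A.atom m, A.incl m, A.cont m, if m = 0 then A.top else A.junk, if m = 0 then A.bot else A.junk,
    A.neg (r m), A.and (r m.unpair.1) (r m.unpair.2), A.or (r m.unpair.1) (r m.unpair.2),
    A.imp (r m.unpair.1) (r m.unpair.2), A.byW m.unpair.1 (r m.unpair.2),
    A.byN m.unpair.1 (r m.unpair.2)].getD t A.junk

/-- The recursion on Goedel numbers that computes the values of formulas, see `fold_code`. -/
def fold (c : ℕ) : σ :=
  A.step c.unpair.1 c.unpair.2 fun i => if i < c then fold i else A.junk
termination_by c

variable {A}

theorem step_congr {t m : ℕ} {r r' : ℕ → σ} (h : ∀ i ≤ m, r i = r' i) :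
    A.step t m r = A.step t m r' := by
  simp only [step, h m le_rfl, h _ (Nat.unpair_left_le m), h _ (Nat.unpair_right_le m)]

theorem fold_pair (t m : ℕ) : A.fold (Nat.pair t m) = A.step t m A.fold := by
  rw [fold, Nat.unpair_pair]
  cases t with
  | zero => rfl
  | succ t =>
    refine step_congr fun i hi => if_pos ?_
    have := Nat.add_le_pair (t + 1) m
    omega

theorem fold_code {s : Kind} (α : Fml s) : A.fold α.code = A.eval α := by
  induction α <;> simp_all [Fml.code, fold_pair, step, eval]

end Fold

/-- A family of algebras whose operations are primitive recursive, uniformly in the parameter. -/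
structure IsPrimrec {α σ : Type*} [Primcodable α] [Primcodable σ] (A : α → FmlAlgebra σ) :
    Prop where
  junk : Primrec fun a => (A a).junk
  atom : Primrec₂ fun a => (A a).atom
  incl : Primrec₂ fun a => (A a).incl
  cont : Primrec₂ fun a => (A a).cont
  top : Primrec fun a => (A a).top
  bot : Primrec fun a => (A a).bot
  neg : Primrec₂ fun a => (A a).neg
  and : Primrec₂ fun a (x : σ × σ) => (A a).and x.1 x.2
  or : Primrec₂ fun a (x : σ × σ) => (A a).or x.1 x.2
  imp : Primrec₂ fun a (x : σ × σ) => (A a).imp x.1 x.2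
  byW : Primrec₂ fun a (x : ℕ × σ) => (A a).byW x.1 x.2
  byN : Primrec₂ fun a (x : ℕ × σ) => (A a).byN x.1 x.2

section Primrec

variable {α β σ : Type*} [Primcodable α] [Primcodable β] [Primcodable σ] {A : α → FmlAlgebra σ}

theorem IsPrimrec.step (hA : IsPrimrec A) {a : β → α} {t m : β → ℕ} {r : β → ℕ → σ}
    (ha : Primrec a) (ht : Primrec t) (hm : Primrec m) (hr : Primrec₂ r) :
    Primrec fun b => (A (a b)).step (t b) (m b) (r b) := by
  have hl : Primrec fun b => (m b).unpair.1 := .comp .fst (Primrec.unpair.comp hm)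
  have hu : Primrec fun b => (m b).unpair.2 := .comp .snd (Primrec.unpair.comp hm)
  have hrm : Primrec fun b => r b (m b) := hr.comp .id hm
  have hrl : Primrec fun b => r b (m b).unpair.1 := hr.comp .id hl
  have hru : Primrec fun b => r b (m b).unpair.2 := hr.comp .id hu
  have hm0 : PrimrecPred fun b => m b = 0 := Primrec.eq.comp hm (.const 0)
  refine Primrec.option_getD.comp (Primrec.list_getElem?.comp ?_ ht) (hA.junk.comp ha)
  refine Primrec.list_cons.comp (hA.atom.comp ha hm) <|
    Primrec.list_cons.comp (hA.incl.comp ha hm) <|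
    Primrec.list_cons.comp (hA.cont.comp ha hm) <|
    Primrec.list_cons.comp (.ite hm0 (hA.top.comp ha) (hA.junk.comp ha)) <|
    Primrec.list_cons.comp (.ite hm0 (hA.bot.comp ha) (hA.junk.comp ha)) <|
    Primrec.list_cons.comp (hA.neg.comp ha hrm) <|
    Primrec.list_cons.comp (hA.and.comp ha (hrl.pair hru)) <|
    Primrec.list_cons.comp (hA.or.comp ha (hrl.pair hru)) <|
    Primrec.list_cons.comp (hA.imp.comp ha (hrl.pair hru)) <|
    Primrec.list_cons.comp (hA.byW.comp ha (hl.pair hru)) <|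
    Primrec.list_cons.comp (hA.byN.comp ha (hl.pair hru)) (.const [])

theorem IsPrimrec.fold (hA : IsPrimrec A) : Primrec₂ fun a c => (A a).fold c := by
  have hlen : Primrec fun x : α × List σ => x.2.length.unpair :=
    Primrec.unpair.comp (Primrec.list_length.comp .snd)
  have hlookup : Primrec₂ fun (x : α × List σ) i => (x.2[i]?).getD (A x.1).junk :=
    Primrec.option_getD.comp (Primrec.list_getElem?.comp (.comp .snd .fst) .snd)
      (hA.junk.comp (.comp .fst .fst))
  have hstep := Primrec.option_some.comp (hA.step .fst (.comp .fst hlen) (.comp .snd hlen) hlookup)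
  refine Primrec.nat_strong_rec _ hstep.to₂ fun a c => ?_
  simp only [List.length_map, List.length_range, Option.some_inj]
  conv_rhs => rw [FmlAlgebra.fold]
  congr 1
  funext i
  split_ifs with hi <;> simp [hi]

end Primrec

end FmlAlgebra

/-- The kinds of formulas with a given Goedel number: the components tell whether it is the number
of a formula of `F_n` and of `F_w`. -/
def kindAlgebra : FmlAlgebra (Bool × Bool) where
  junk := (false, false)
  atom _ := (true, false)
  incl _ := (false, true)
  cont _ := (false, true)
  top := (true, true)
  bot := (true, true)
  neg x := x
  and x y := x ⊓ y
  or x y := x ⊓ y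
  imp x y := x ⊓ y
  byW _ x := (false, x.1)
  byN _ x := (x.2, false)

theorem kindAlgebra_isPrimrec : FmlAlgebra.IsPrimrec fun _ : Unit => kindAlgebra where
  junk := .const _
  atom := .const _
  incl := .const _
  cont := .const _
  top := .const _
  bot := .const _
  neg := .snd
  and := (Primrec.dom_finite fun x : (Bool × Bool) × Bool × Bool => x.1 ⊓ x.2).comp .snd
  or := (Primrec.dom_finite fun x : (Bool × Bool) × Bool × Bool => x.1 ⊓ x.2).comp .snd
  imp := (Primrec.dom_finite fun x : (Bool × Bool) × Bool × Bool => x.1 ⊓ x.2).comp .snd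
  byW := (Primrec.dom_finite fun x : Bool × Bool => (false, x.1)).comp (.comp .snd .snd)
  byN := (Primrec.dom_finite fun x : Bool × Bool => (x.2, false)).comp (.comp .snd .snd)

/-- The component of a value of `kindAlgebra` for the formulas of kind `s`. -/
def Kind.proj : Kind → Bool × Bool → Bool
  | .n => Prod.fst
  | .w => Prod.snd

theorem Kind.proj_inf (s : Kind) (x y : Bool × Bool) : s.proj (x ⊓ y) = (s.proj x && s.proj y) := by
  cases s <;> rfl

theorem kindAlgebra_eval {s : Kind} (α : Fml s) : s.proj (kindAlgebra.eval α) = true := by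
  induction α with
  | atom | incl | cont => rfl
  | @top s | @bot s => cases s <;> rfl
  | neg _ ih => exact ih
  | @and s _ _ ih₁ ih₂ | @or s _ _ ih₁ ih₂ | @imp s _ _ ih₁ ih₂ =>
    exact (s.proj_inf _ _).trans (Bool.and_eq_true_iff.2 ⟨ih₁, ih₂⟩)
  | byW _ _ ih | byN _ _ ih => exact ih

theorem NLabel.exists_code_eq : ∀ c, ∃ φ : NLabel, φ.code = c
  | 0 => ⟨.all, rfl⟩
  | 1 => ⟨.ex, rfl⟩
  | N + 2 => ⟨.var N, rfl⟩

theorem WLabel.exists_code_eq : ∀ c, ∃ φ : WLabel, φ.code = c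
  | 0 => ⟨.all, rfl⟩
  | 1 => ⟨.ex, rfl⟩
  | z + 2 => ⟨.var z, rfl⟩

section ExistsCodeEq

variable {m : ℕ}
  (ih : ∀ c ≤ m, ∀ {s : Kind}, s.proj (kindAlgebra.fold c) = true → ∃ α : Fml s, α.code = c)
include ih

theorem exists_pair_code_eq {s : Kind}
    (h : s.proj (kindAlgebra.fold m.unpair.1 ⊓ kindAlgebra.fold m.unpair.2) = true) :
    ∃ α β : Fml s, Nat.pair α.code β.code = m := by
  rw [Kind.proj_inf, Bool.and_eq_true_iff] at h
  obtain ⟨α, hα⟩ := ih _ (Nat.unpair_left_le m) h.1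
  obtain ⟨β, hβ⟩ := ih _ (Nat.unpair_right_le m) h.2
  exact ⟨α, β, by rw [hα, hβ, Nat.pair_unpair]⟩

theorem exists_pair_left_code_eq {s : Kind} (h : s.proj (kindAlgebra.fold m.unpair.2) = true) :
    ∃ α : Fml s, Nat.pair m.unpair.1 α.code = m := by
  obtain ⟨α, hα⟩ := ih _ (Nat.unpair_right_le m) h
  exact ⟨α, by rw [hα, Nat.pair_unpair]⟩

end ExistsCodeEq

theorem exists_code_eq_of_step {m : ℕ} : ∀ {t : ℕ} {s : Kind},
    (t ≠ 0 → ∀ c ≤ m, ∀ {s : Kind}, s.proj (kindAlgebra.fold c) = true →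
      ∃ α : Fml s, α.code = c) →
    s.proj (kindAlgebra.step t m kindAlgebra.fold) = true → ∃ α : Fml s, α.code = Nat.pair t m
  | 0, .n, _, _ => ⟨.atom m, rfl⟩
  | 1, .w, _, _ => ⟨.incl m, rfl⟩
  | 2, .w, _, _ => ⟨.cont m, rfl⟩
  | 3, s, _, h => by
    obtain rfl : m = 0 := by
      by_contra hm
      cases s <;> simp [FmlAlgebra.step, Kind.proj, kindAlgebra, hm] at h
    exact ⟨.top, rfl⟩
  | 4, s, _, h => by
    obtain rfl : m = 0 := by
      by_contra hm
      cases s <;> simp [FmlAlgebra.step, Kind.proj, kindAlgebra, hm] at h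
    exact ⟨.bot, rfl⟩
  | 5, _, ih, h =>
    let ⟨α, hα⟩ := ih (by simp) m le_rfl h
    ⟨.neg α, by rw [Fml.code, hα]⟩
  | 6, _, ih, h =>
    let ⟨α, β, hm⟩ := exists_pair_code_eq (ih (by simp)) h
    ⟨.and α β, by rw [Fml.code, hm]⟩
  | 7, _, ih, h =>
    let ⟨α, β, hm⟩ := exists_pair_code_eq (ih (by simp)) h
    ⟨.or α β, by rw [Fml.code, hm]⟩
  | 8, _, ih, h =>
    let ⟨α, β, hm⟩ := exists_pair_code_eq (ih (by simp)) h
    ⟨.imp α β, by rw [Fml.code, hm]⟩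
  | 9, .w, ih, h =>
    let ⟨α, hm⟩ := exists_pair_left_code_eq (s := .n) (ih (by simp)) h
    let ⟨φ, hφ⟩ := WLabel.exists_code_eq m.unpair.1
    ⟨.byW φ α, by rw [Fml.code, hφ, hm]⟩
  | 10, .n, ih, h =>
    let ⟨α, hm⟩ := exists_pair_left_code_eq (s := .w) (ih (by simp)) h
    let ⟨φ, hφ⟩ := NLabel.exists_code_eq m.unpair.1
    ⟨.byN φ α, by rw [Fml.code, hφ, hm]⟩
  | 0, .w, _, h | 1, .n, _, h | 2, .n, _, h | 9, .n, _, h | 10, .w, _, h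
  | _ + 11, .n, _, h | _ + 11, .w, _, h => nomatch h

theorem exists_code_eq_of_fold (c : ℕ) {s : Kind} (h : s.proj (kindAlgebra.fold c) = true) :
    ∃ α : Fml s, α.code = c := by
  induction c using Nat.strong_induction_on generalizing s with
  | _ c ih =>
    rw [← Nat.pair_unpair c, FmlAlgebra.fold_pair] at h
    rw [← Nat.pair_unpair c]
    refine exists_code_eq_of_step (fun ht i hi _ => ih i ?_) h
    have := Nat.add_le_pair c.unpair.1 c.unpair.2
    rw [Nat.pair_unpair] at this
    omega

theorem primrecPred_exists_code_eq (s : Kind) : PrimrecPred fun c => ∃ α : Fml s, α.code = c := by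
  have hproj : Primrec fun c => s.proj (kindAlgebra.fold c) :=
    (Primrec.dom_finite s.proj).comp (kindAlgebra_isPrimrec.fold.comp (.const ()) .id)
  refine (Primrec.eq.comp hproj (.const true)).of_eq fun c => ⟨exists_code_eq_of_fold c, ?_⟩
  rintro ⟨α, rfl⟩
  exact FmlAlgebra.fold_code α ▸ kindAlgebra_eval α

theorem DecidableSet.of_primrecPred {s : Kind} {P : Fml s → Prop} {Q : ℕ → Prop}
    (hQ : PrimrecPred Q) (h : ∀ α, P α ↔ Q α.code) : DecidableSet P := by
  refine ((primrecPred_exists_code_eq s).and hQ).computablePred.of_eq fun c => ?_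
  constructor
  · rintro ⟨⟨α, rfl⟩, hc⟩
    exact ⟨α, rfl, (h α).2 hc⟩
  · rintro ⟨α, rfl, hα⟩
    exact ⟨⟨α, rfl⟩, (h α).1 hα⟩

/-- The recursion that computes Goedel numbers of label-free formulas, with given treatment of
proposition symbols and labels. -/
def labelFreeAlgebra (atom label : ℕ → ℕ) : FmlAlgebra ℕ where
  junk := 0
  atom := atom
  incl _ := Fml.code (.top : Fml .n)
  cont _ := Fml.code (.top : Fml .n)
  top := Fml.code (.top : Fml .n)
  bot := Fml.code (.bot : Fml .n)
  neg a := Nat.pair 5 a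
  and a b := Nat.pair 6 (Nat.pair a b)
  or a b := Nat.pair 7 (Nat.pair a b)
  imp a b := Nat.pair 8 (Nat.pair a b)
  byW _ := label
  byN _ := label

theorem labelFreeAlgebra_isPrimrec {atom label : ℕ → ℕ} (hatom : Primrec atom)
    (hlabel : Primrec label) :
    FmlAlgebra.IsPrimrec fun _ : Unit => labelFreeAlgebra atom label where
  junk := .const _
  atom := hatom.comp .snd
  incl := .const _
  cont := .const _
  top := .const _
  bot := .const _
  neg := Primrec₂.natPair.comp (.const 5) .snd
  and := Primrec₂.natPair.comp (.const 6) <|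
    Primrec₂.natPair.comp (.comp .fst .snd) (.comp .snd .snd)
  or := Primrec₂.natPair.comp (.const 7) <|
    Primrec₂.natPair.comp (.comp .fst .snd) (.comp .snd .snd)
  imp := Primrec₂.natPair.comp (.const 8) <|
    Primrec₂.natPair.comp (.comp .fst .snd) (.comp .snd .snd)
  byW := hlabel.comp (.comp .snd .snd)
  byN := hlabel.comp (.comp .snd .snd)

/-- The recursion that increases by one the depths stored in the symbols of a flattened formula. -/
def raiseAlgebra : FmlAlgebra ℕ :=
  labelFreeAlgebra (fun q => Nat.pair 0 (Nat.pair (q.unpair.1 + 1) q.unpair.2)) id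

theorem raiseAlgebra_eval_flatten {s : Kind} (α : Fml s) (d : ℕ) :
    raiseAlgebra.eval (α.flatten d) = (α.flatten (d + 1)).code := by
  induction α generalizing d <;>
    simp_all [FmlAlgebra.eval, Fml.flatten, Fml.code, raiseAlgebra, labelFreeAlgebra]

/-- The recursion that computes the Goedel number of `α.flatten 0`. -/
def flattenAlgebra : FmlAlgebra ℕ :=
  labelFreeAlgebra (fun p => Nat.pair 0 (Nat.pair 0 p)) raiseAlgebra.fold

theorem flattenAlgebra_eval {s : Kind} (α : Fml s) :
    flattenAlgebra.eval α = (α.flatten 0).code := by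
  have hlabel {s : Kind} (α : Fml s) : raiseAlgebra.fold (α.flatten 0).code = (α.flatten 1).code :=
    (FmlAlgebra.fold_code _).trans (raiseAlgebra_eval_flatten α 0)
  induction α <;>
    simp_all [FmlAlgebra.eval, Fml.flatten, Fml.code, flattenAlgebra, labelFreeAlgebra]

theorem primrec_flattenAlgebra_fold : Primrec flattenAlgebra.fold := by
  have hraise : Primrec fun q : ℕ => Nat.pair 0 (Nat.pair (q.unpair.1 + 1) q.unpair.2) :=
    Primrec₂.natPair.comp (.const 0) <| Primrec₂.natPair.comp
      (Primrec.succ.comp (.comp .fst Primrec.unpair)) (.comp .snd Primrec.unpair)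
  have hatom : Primrec fun p => Nat.pair 0 (Nat.pair 0 p) :=
    Primrec₂.natPair.comp (.const 0) (Primrec₂.natPair.comp (.const 0) .id)
  have hlabel : Primrec raiseAlgebra.fold :=
    (labelFreeAlgebra_isPrimrec hraise .id).fold.comp (.const ()) .id
  exact (labelFreeAlgebra_isPrimrec hatom hlabel).fold.comp (.const ()) .id

/-! ### Finite countermodels -/

section Double

variable {W : Type u} {T : Type*} {τ : W → T}

/-- The image of a set of worlds under `τ`, with two copies of each class (fibre of `τ`): the
second copy of a class belongs to the image iff the whole class is in the set. Unlike for the plain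
image, inclusions between images are inclusions between the sets as soon as one set is saturated. -/
def double (τ : W → T) (S : Set W) : Set (T × Bool) :=
  {q | ∃ v ∈ S, τ v = q.1 ∧ (q.2 = true → ∀ w, τ w = q.1 → w ∈ S)}

theorem double_mono {S S' : Set W} (h : S ⊆ S') : double τ S ⊆ double τ S' :=
  fun _ ⟨v, hv, e, hq⟩ => ⟨v, h hv, e, fun hb w hw => h (hq hb w hw)⟩

theorem mem_double_false {S : Set W} {t : T} :
    (t, false) ∈ double τ S ↔ ∃ v ∈ S, τ v = t := by
  simp [double]

/-- A set of worlds is saturated if it is a union of classes. -/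
def Saturated (τ : W → T) (S : Set W) : Prop :=
  ∀ ⦃v w⦄, τ v = τ w → v ∈ S → w ∈ S

variable {A S : Set W} (hA : Saturated τ A)
include hA

theorem double_subset_iff_left : double τ A ⊆ double τ S ↔ A ⊆ S := by
  refine ⟨fun h v hv => ?_, double_mono⟩
  have hmem : (τ v, true) ∈ double τ A := ⟨v, hv, rfl, fun _ _ hw => hA hw.symm hv⟩
  obtain ⟨_, _, _, hclass⟩ := h hmem
  exact hclass rfl v rfl

theorem double_subset_iff_right : double τ S ⊆ double τ A ↔ S ⊆ A := by
  refine ⟨fun h v hv => ?_, double_mono⟩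
  obtain ⟨w, hw, e⟩ := mem_double_false.1 (h (mem_double_false.2 ⟨v, hv, rfl⟩))
  exact hA e hw

theorem double_eq_iff : double τ S = double τ A ↔ S = A := by
  simp only [Set.Subset.antisymm_iff, double_subset_iff_left hA, double_subset_iff_right hA]

end Double

section Filtration

variable {W : Type u} {T : Type*} {F : Frame W} {σ : Assignment W} {k : ℕ} {τ : W → T}

/-- Identifying worlds along `τ` respects the formulas with Goedel number at most `k` and the
variables with number at most `k`. -/
structure IsFiltration (F : Frame W) (σ : Assignment W) (k : ℕ) (τ : W → T) : Prop where
  sat_congr ⦃v w : W⦄ : τ v = τ w → ∀ {α : Fml .n}, α.code ≤ k → (Sat F σ α v ↔ Sat F σ α w)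
  eq_world ⦃v : W⦄ {z : ℕ} : z ≤ k → τ v = τ (σ.world z) → v = σ.world z
  saturated {N : ℕ} : N ≤ k → Saturated τ (σ.nbhd N)

/-- The filtration of an assignment along `τ`. -/
def Assignment.filtration (σ : Assignment W) (τ : W → T) : Assignment (T × Bool) where
  world z := (τ (σ.world z), false)
  nbhd N := double τ (σ.nbhd N)
  nbhd_nonempty N :=
    let ⟨v, hv⟩ := σ.nbhd_nonempty N
    ⟨_, mem_double_false.2 ⟨v, hv, rfl⟩⟩

variable [Nonempty W]

/-- The filtration of a frame along `τ`; the neighbourhoods of a class are those of a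
representative. -/
noncomputable def Frame.filtration (F : Frame W) (τ : W → T) : Frame (T × Bool) where
  nest q := double τ '' F.nest (Function.invFun τ q.1)
  nested := by
    rintro q _ ⟨S, hS, rfl⟩ _ ⟨S', hS', rfl⟩
    exact (F.nested _ S hS S' hS').imp double_mono double_mono
  val p := {q | Function.invFun τ q.1 ∈ F.val p}

/-- The relation between structures over the filtration and over the original frame under which
satisfaction is preserved. -/
def FiltrationRel (F : Frame W) (τ : W → T) :
    {s : Kind} → Struc (F.filtration τ) s → Struc F s → Prop
  | .n => fun q w => q.1 = τ w
  | .w => fun X Y => Function.invFun τ X.ref.1 = Y.ref ∧ X.nbhd = double τ Y.nbhd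

/-- The statement of `sat_filtration` for a single formula. -/
def SatFiltration (F : Frame W) (σ : Assignment W) (τ : W → T) {s : Kind} (α : Fml s) : Prop :=
  ∀ x y, FiltrationRel F τ x y → (Sat (F.filtration τ) (σ.filtration τ) α x ↔ Sat F σ α y)

theorem apply_invFun_apply (τ : W → T) (w : W) : τ (Function.invFun τ (τ w)) = τ w :=
  Function.invFun_eq ⟨w, rfl⟩

namespace IsFiltration

variable (hτ : IsFiltration F σ k τ)
include hτ

theorem nbhd_mem_nest_iff {N : ℕ} (hN : N ≤ k) (q : T × Bool) :
    (σ.filtration τ).nbhd N ∈ (F.filtration τ).nest q ↔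
      σ.nbhd N ∈ F.nest (Function.invFun τ q.1) :=
  ⟨fun ⟨_, hS, e⟩ => (double_eq_iff (hτ.saturated hN)).1 e ▸ hS, fun h => ⟨_, h, rfl⟩⟩

theorem satFiltration_atom {p : ℕ} (hp : (Fml.atom p).code ≤ k) :
    SatFiltration F σ τ (.atom p) := by
  rintro ⟨_, b⟩ w (rfl : _ = τ w)
  exact hτ.sat_congr (α := .atom p) (apply_invFun_apply τ w) hp

theorem satFiltration_incl {M : ℕ} (hM : M ≤ k) : SatFiltration F σ τ (.incl M) := by
  rintro ⟨q, _, _⟩ ⟨_, S, _⟩ ⟨rfl : Function.invFun τ q.1 = _, rfl : _ = double τ S⟩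
  exact and_congr (hτ.nbhd_mem_nest_iff hM q) (double_subset_iff_left (hτ.saturated hM))

theorem satFiltration_cont {M : ℕ} (hM : M ≤ k) : SatFiltration F σ τ (.cont M) := by
  rintro ⟨q, _, _⟩ ⟨_, S, _⟩ ⟨rfl : Function.invFun τ q.1 = _, rfl : _ = double τ S⟩
  exact and_congr (hτ.nbhd_mem_nest_iff hM q) (double_subset_iff_right (hτ.saturated hM))

theorem satFiltration_byW {φ : WLabel} (hφ : φ.code ≤ k) {α : Fml .n}
    (ih : SatFiltration F σ τ α) : SatFiltration F σ τ (.byW φ α) := by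
  rintro ⟨q, _, _⟩ ⟨_, S, _⟩ ⟨rfl : Function.invFun τ q.1 = _, rfl : _ = double τ S⟩
  have hα v b : Sat (F.filtration τ) (σ.filtration τ) α (τ v, b) ↔ Sat F σ α v := ih (τ v, b) v rfl
  cases φ with
  | all =>
    constructor
    · exact fun h v hv => (hα v false).1 (h _ (mem_double_false.2 ⟨v, hv, rfl⟩))
    · rintro h ⟨_, b⟩ ⟨v, hv, rfl, _⟩
      exact (hα v b).2 (h v hv)
  | ex =>
    constructor
    · rintro ⟨⟨_, b⟩, ⟨v, hv, rfl, _⟩, h⟩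
      exact ⟨v, hv, (hα v b).1 h⟩
    · rintro ⟨v, hv, h⟩
      exact ⟨_, mem_double_false.2 ⟨v, hv, rfl⟩, (hα v false).2 h⟩
  | var z =>
    have hz : z ≤ k := (Nat.le_add_right z 2).trans hφ
    refine and_congr (mem_double_false.trans ⟨?_, fun h => ⟨_, h, rfl⟩⟩) (hα _ _)
    rintro ⟨v, hv, e⟩
    exact hτ.eq_world hz e ▸ hv

theorem satFiltration_byN {φ : NLabel} (hφ : φ.code ≤ k) {α : Fml .w}
    (hφα : (Fml.byN φ α).code ≤ k) (ih : SatFiltration F σ τ α) :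
    SatFiltration F σ τ (.byN φ α) := by
  rintro ⟨_, b⟩ w (rfl : _ = τ w)
  rw [← hτ.sat_congr (apply_invFun_apply τ w) hφα]
  have hα S hS hS' : Sat (F.filtration τ) (σ.filtration τ) α ⟨(τ w, b), double τ S, hS⟩ ↔
      Sat F σ α ⟨Function.invFun τ (τ w), S, hS'⟩ := ih _ _ ⟨rfl, rfl⟩
  cases φ with
  | all =>
    constructor
    · exact fun h S hS => (hα S ⟨S, hS, rfl⟩ hS).1 (h _ _)
    · rintro h _ ⟨S, hS, rfl⟩
      exact (hα S _ hS).2 (h S hS)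
  | ex =>
    constructor
    · rintro ⟨_, ⟨S, hS, rfl⟩, h⟩
      exact ⟨S, hS, (hα S _ hS).1 h⟩
    · rintro ⟨S, hS, h⟩
      exact ⟨_, ⟨S, hS, rfl⟩, (hα S _ hS).2 h⟩
  | var N =>
    have hN : N ≤ k := (Nat.le_add_right N 2).trans hφ
    have hmem := hτ.nbhd_mem_nest_iff hN (τ w, b)
    exact ⟨fun ⟨hS, h⟩ => ⟨hmem.1 hS, (hα _ hS _).1 h⟩, fun ⟨hS, h⟩ => ⟨hmem.2 hS, (hα _ _ hS).2 h⟩⟩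

theorem sat_filtration {s : Kind} {α : Fml s} (hα : α.code ≤ k) : SatFiltration F σ τ α := by
  have right {a b : ℕ} (h : Nat.pair a b ≤ k) : b ≤ k := (Nat.right_le_pair _ _).trans h
  have left {a b : ℕ} (h : Nat.pair a b ≤ k) : a ≤ k := (Nat.left_le_pair _ _).trans h
  induction α with
  | atom p => exact hτ.satFiltration_atom hα
  | incl M => exact hτ.satFiltration_incl (right hα)
  | cont M => exact hτ.satFiltration_cont (right hα)
  | top | bot => exact fun x y _ => Iff.rfl
  | neg α ih => exact fun x y h => not_congr (ih (right hα) x y h)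
  | and α β ih₁ ih₂ =>
    exact fun x y h => and_congr (ih₁ (left (right hα)) x y h) (ih₂ (right (right hα)) x y h)
  | or α β ih₁ ih₂ =>
    exact fun x y h => or_congr (ih₁ (left (right hα)) x y h) (ih₂ (right (right hα)) x y h)
  | imp α β ih₁ ih₂ =>
    exact fun x y h =>
      or_congr (not_congr (ih₁ (left (right hα)) x y h)) (ih₂ (right (right hα)) x y h)
  | byW φ α ih => exact hτ.satFiltration_byW (left (right hα)) (ih (right (right hα)))
  | byN φ α ih => exact hτ.satFiltration_byN (left (right hα)) hα (ih (right (right hα)))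

end IsFiltration

omit [Nonempty W]

/-- The formulas with Goedel number at most `k` that hold at a world, the world variables with
number at most `k` that denote it, and the neighbourhood variables with number at most `k` whose
denotation contains it. -/
def worldType (F : Frame W) (σ : Assignment W) (k : ℕ) (w : W) : Fin (k + 1) → Prop × Prop × Prop :=
  fun i => (∃ α : Fml .n, α.code = i ∧ Sat F σ α w, w = σ.world i, w ∈ σ.nbhd i)

theorem isFiltration_worldType : IsFiltration F σ k (worldType F σ k) where
  sat_congr v w h α hα := by
    have := congrArg Prod.fst (congrFun h ⟨α.code, Nat.lt_succ_of_le hα⟩)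
    simpa [worldType, Fml.code_injective.eq_iff] using this
  eq_world v z hz h := by
    simpa [worldType] using congrArg (·.2.1) (congrFun h ⟨z, Nat.lt_succ_of_le hz⟩)
  saturated {N} hN v w h := by
    have := congrArg (·.2.2) (congrFun h ⟨N, Nat.lt_succ_of_le hN⟩)
    simp only [worldType, eq_iff_iff] at this
    exact this.1

theorem exists_finite_countermodel {φ : Fml .n} (hφ : φ.code ≤ k) (h : ¬ Valid.{u} φ) :
    ∃ (W : Type) (_ : W ≃ Fin (2 * 8 ^ (k + 1))) (F : Frame W) (σ : Assignment W) (x : W),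
      ¬ Sat F σ φ x := by
  simp only [Valid, not_forall] at h
  obtain ⟨W, F, σ, x, h⟩ := h
  have : Nonempty W := ⟨x⟩
  let τ := worldType F σ k
  have hτ : IsFiltration F σ k τ := isFiltration_worldType
  refine ⟨(Fin (k + 1) → Prop × Prop × Prop) × Bool,
    Fintype.equivFinOfCardEq (by simp [mul_comm]), F.filtration τ, σ.filtration τ,
    (τ x, false), ?_⟩
  exact (not_congr (hτ.sat_filtration hφ (τ x, false) x (by exact rfl))).2 h

end Filtration

/-! ### Finite models as numbers -/

/-- The digit number `i`, counted from the least significant one, of `a` in base `b`. -/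
def digit (b a i : ℕ) : ℕ := a / b ^ i % b

theorem exists_digit_eq {b n : ℕ} {f : ℕ → ℕ} (hf : ∀ i < n, f i < b) :
    ∃ a < b ^ n, ∀ i < n, digit b a i = f i := by
  let g : Fin n → Fin b := fun i => ⟨f i, hf i i.2⟩
  refine ⟨finFunctionFinEquiv g, (finFunctionFinEquiv g).2, fun i hi => ?_⟩
  exact congrArg Fin.val (congrFun (finFunctionFinEquiv.symm_apply_apply g) ⟨i, hi⟩)

theorem exists_testBit_iff (n : ℕ) (P : ℕ → Prop) :
    ∃ a < 2 ^ n, ∀ i < n, a.testBit i = true ↔ P i := by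
  classical
  refine ⟨Nat.ofBits fun i : Fin n => decide (P i), Nat.ofBits_lt_two_pow _, fun i hi => ?_⟩
  simp [Nat.testBit_ofBits_lt _ i hi]

/-- Numbers that determine a finite model with the worlds `0, …, m - 1` up to variables: `m`,
followed by four tables, written as the digits of numbers, for the valuation, the nesting function
and the values of the world and the neighbourhood variables. Sets are given by bit masks. -/
abbrev ModelCode : Type := ℕ × ℕ × ℕ × ℕ × ℕ

namespace ModelCode

variable (M : ModelCode)

/-- The number of worlds. -/
def size : ℕ := M.1

/-- The mask of the set of worlds at which a proposition symbol holds. -/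
def val (p : ℕ) : ℕ := digit (2 ^ M.size) M.2.1 p

/-- The mask of the set of (masks of) neighbourhoods of a world. -/
def nest (x : ℕ) : ℕ := digit (2 ^ 2 ^ M.size) M.2.2.1 x

/-- The value of a world variable. -/
def world (z : ℕ) : ℕ := digit M.size M.2.2.2.1 z

/-- The mask of the value of a neighbourhood variable. -/
def nbhd (N : ℕ) : ℕ := digit (2 ^ M.size) M.2.2.2.2 N

/-- Inclusion of masks of sets of worlds. -/
abbrev Sub (i j : ℕ) : Prop := ∀ y < M.size, i.testBit y = true → j.testBit y = true

/-- The pairs of a world and a mask of a set of worlds. Formulas of `F_n` are evaluated at the first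
component and formulas of `F_w` at the pair. -/
def points : List (ℕ × ℕ) := (List.range M.size).product (List.range (2 ^ M.size))

variable {M}

theorem nbhd_lt {N : ℕ} : M.nbhd N < 2 ^ M.size := Nat.mod_lt _ (by positivity)

theorem mem_points {q : ℕ × ℕ} : q ∈ M.points ↔ q.1 < M.size ∧ q.2 < 2 ^ M.size := by
  rw [← q.eta, points, List.pair_mem_product, List.mem_range, List.mem_range]

variable (M)

/-- Model checking: the value of a formula is the list of the points at which it holds. -/
def algebra : FmlAlgebra (List (ℕ × ℕ)) where
  junk := []
  atom p := M.points.filter fun q => (M.val p).testBit q.1 = true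
  incl N := M.points.filter fun q => (M.nest q.1).testBit (M.nbhd N) ∧ M.Sub (M.nbhd N) q.2
  cont N := M.points.filter fun q => (M.nest q.1).testBit (M.nbhd N) ∧ M.Sub q.2 (M.nbhd N)
  top := M.points
  bot := []
  neg a := M.points.filter fun q => q ∉ a
  and a b := M.points.filter fun q => q ∈ a ∧ q ∈ b
  or a b := M.points.filter fun q => q ∈ a ∨ q ∈ b
  imp a b := M.points.filter fun q => q ∉ a ∨ q ∈ b
  byW φ a :=
    if φ = 0 then M.points.filter fun q => ∀ y < M.size, q.2.testBit y → (y, q.2) ∈ a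
    else if φ = 1 then M.points.filter fun q => ∃ y < M.size, q.2.testBit y ∧ (y, q.2) ∈ a
    else M.points.filter fun q => q.2.testBit (M.world (φ - 2)) ∧ (M.world (φ - 2), q.2) ∈ a
  byN φ a :=
    if φ = 0 then M.points.filter fun q =>
      ∀ j < 2 ^ M.size, (M.nest q.1).testBit j → (q.1, j) ∈ a
    else if φ = 1 then M.points.filter fun q =>
      ∃ j < 2 ^ M.size, (M.nest q.1).testBit j ∧ (q.1, j) ∈ a
    else M.points.filter fun q =>
      (M.nest q.1).testBit (M.nbhd (φ - 2)) ∧ (q.1, M.nbhd (φ - 2)) ∈ a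

end ModelCode

section Mask

variable {W : Type*} {m : ℕ} (e : W ≃ Fin m)

theorem forall_lt_iff_forall_equiv {P : ℕ → Prop} : (∀ y < m, P y) ↔ ∀ w, P (e w) :=
  Fin.forall_iff.symm.trans (e.forall_congr_right (q := fun y : Fin m => P y)).symm

theorem exists_lt_iff_exists_equiv {P : ℕ → Prop} : (∃ y < m, P y) ↔ ∃ w, P (e w) := by
  refine Iff.trans ?_ (e.exists_congr_right (q := fun y : Fin m => P y)).symm
  simp [Fin.exists_iff]

/-- The set of worlds with a given mask. -/
def maskSet (j : ℕ) : Set W := {w | j.testBit (e w) = true}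

theorem exists_maskSet_eq (S : Set W) : ∃ j < 2 ^ m, maskSet e j = S := by
  obtain ⟨j, hj, h⟩ := exists_testBit_iff m fun i => ∃ w ∈ S, (e w : ℕ) = i
  refine ⟨j, hj, Set.ext fun w => (h _ (e w).2).trans ?_⟩
  simp [Fin.val_inj]

theorem maskSet_injOn : Set.InjOn (maskSet e) {j | j < 2 ^ m} := by
  refine fun i hi j hj h => Nat.eq_of_testBit_eq fun y => ?_
  by_cases hy : y < m
  · exact (forall_lt_iff_forall_equiv (P := fun y => i.testBit y = j.testBit y) e).2
      (fun w => Bool.eq_iff_iff.2 (Set.ext_iff.1 h w)) y hy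
  · have := Nat.pow_le_pow_right two_pos (not_lt.1 hy)
    rw [Nat.testBit_lt_two_pow (hi.trans_le this), Nat.testBit_lt_two_pow (hj.trans_le this)]

theorem forall_set_iff_forall_maskSet {P : Set W → Prop} :
    (∀ S, P S) ↔ ∀ j < 2 ^ m, P (maskSet e j) :=
  ⟨fun h _ _ => h _, fun h S => let ⟨j, hj, hS⟩ := exists_maskSet_eq e S; hS ▸ h j hj⟩

theorem exists_set_iff_exists_maskSet {P : Set W → Prop} :
    (∃ S, P S) ↔ ∃ j < 2 ^ m, P (maskSet e j) :=
  ⟨fun ⟨S, hS⟩ => let ⟨j, hj, h⟩ := exists_maskSet_eq e S; ⟨j, hj, h.symm ▸ hS⟩,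
    fun ⟨_, _, h⟩ => ⟨_, h⟩⟩

theorem ModelCode.sub_iff {M : ModelCode} (e : W ≃ Fin M.size) {i j : ℕ} :
    M.Sub i j ↔ maskSet e i ⊆ maskSet e j :=
  forall_lt_iff_forall_equiv (P := fun y => i.testBit y = true → j.testBit y = true) e

end Mask

/-- The model code `M` describes the frame `F` and the assignment `σ` via an enumeration `e` of
the worlds, for the symbols and variables with numbers at most `k`. -/
structure Represents (k : ℕ) (M : ModelCode) {W : Type*} (e : W ≃ Fin M.size) (F : Frame W)
    (σ : Assignment W) : Prop where
  val {p : ℕ} : p ≤ k → maskSet e (M.val p) = F.val p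
  nest (x : W) {j : ℕ} : j < 2 ^ M.size →
    ((M.nest (e x)).testBit j = true ↔ maskSet e j ∈ F.nest x)
  world {z : ℕ} : z ≤ k → M.world z = e (σ.world z)
  nbhd {N : ℕ} : N ≤ k → maskSet e (M.nbhd N) = σ.nbhd N

/-- The point `q` stands for a structure over the frame. -/
def PointRel {M : ModelCode} {W : Type*} (e : W ≃ Fin M.size) {F : Frame W} (q : ℕ × ℕ) :
    {s : Kind} → Struc F s → Prop
  | .n => fun y => q ∈ M.points ∧ q.1 = e y
  | .w => fun T => q ∈ M.points ∧ q.1 = e T.ref ∧ maskSet e q.2 = T.nbhd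

/-- The list of points `a` is the value of `α`: membership of a point agrees with satisfaction in
`F` under `σ` at the structure it stands for. -/
def Computes {M : ModelCode} {W : Type*} (e : W ≃ Fin M.size) (F : Frame W) (σ : Assignment W)
    {s : Kind} (a : List (ℕ × ℕ)) (α : Fml s) : Prop :=
  ∀ (q : ℕ × ℕ) (x : Struc F s), PointRel e q x → (q ∈ a ↔ Sat F σ α x)

theorem PointRel.mem_points {M : ModelCode} {W : Type*} {e : W ≃ Fin M.size} {F : Frame W}
    {q : ℕ × ℕ} {s : Kind} {x : Struc F s} (h : PointRel e q x) : q ∈ M.points := by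
  cases s <;> exact h.1

namespace Computes

variable {M : ModelCode} {W : Type u} {e : W ≃ Fin M.size} {F : Frame W} {σ : Assignment W}
  {s : Kind} {a b : List (ℕ × ℕ)} {α β : Fml s}

theorem neg (hα : Computes e F σ a α) : Computes e F σ (M.algebra.neg a) (.neg α) := fun q x h => by
  simp [ModelCode.algebra, Sat, h.mem_points, hα q x h]

theorem and (hα : Computes e F σ a α) (hβ : Computes e F σ b β) :
    Computes e F σ (M.algebra.and a b) (.and α β) := fun q x h => by
  simp [ModelCode.algebra, Sat, h.mem_points, hα q x h, hβ q x h]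

theorem or (hα : Computes e F σ a α) (hβ : Computes e F σ b β) :
    Computes e F σ (M.algebra.or a b) (.or α β) := fun q x h => by
  simp [ModelCode.algebra, Sat, h.mem_points, hα q x h, hβ q x h]

theorem imp (hα : Computes e F σ a α) (hβ : Computes e F σ b β) :
    Computes e F σ (M.algebra.imp a b) (.imp α β) := fun q x h => by
  simp [ModelCode.algebra, Sat, h.mem_points, hα q x h, hβ q x h]

end Computes

namespace Represents

variable {k : ℕ} {M : ModelCode} {W : Type u} {e : W ≃ Fin M.size} {F : Frame W} {σ : Assignment W}
  (hM : Represents k M e F σ)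
include hM

theorem nest_nbhd_iff {N : ℕ} (hN : N ≤ k) (x : W) :
    (M.nest (e x)).testBit (M.nbhd N) = true ↔ σ.nbhd N ∈ F.nest x := by
  rw [hM.nest x M.nbhd_lt, hM.nbhd hN]

theorem computes_atom {p : ℕ} (hp : p ≤ k) : Computes e F σ (M.algebra.atom p) (.atom p) := by
  rintro ⟨i, j⟩ x ⟨hq, rfl : i = e x⟩
  simp [ModelCode.algebra, hq, Sat, ← hM.val hp, maskSet]

theorem computes_incl {N : ℕ} (hN : N ≤ k) : Computes e F σ (M.algebra.incl N) (.incl N) := by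
  rintro ⟨i, j⟩ ⟨x, _, _⟩ ⟨hq, rfl : i = e x, rfl : maskSet e j = _⟩
  simp [ModelCode.algebra, hq, Sat, hM.nest_nbhd_iff hN, ModelCode.sub_iff e, hM.nbhd hN]

theorem computes_cont {N : ℕ} (hN : N ≤ k) : Computes e F σ (M.algebra.cont N) (.cont N) := by
  rintro ⟨i, j⟩ ⟨x, _, _⟩ ⟨hq, rfl : i = e x, rfl : maskSet e j = _⟩
  simp [ModelCode.algebra, hq, Sat, hM.nest_nbhd_iff hN, ModelCode.sub_iff e, hM.nbhd hN]

theorem computes_byW {φ : WLabel} (hφ : φ.code ≤ k) {α : Fml .n} {a : List (ℕ × ℕ)}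
    (ih : Computes e F σ a α) : Computes e F σ (M.algebra.byW φ.code a) (.byW φ α) := by
  rintro ⟨i, j⟩ ⟨x, _, _⟩ ⟨hq, rfl : i = e x, rfl : maskSet e j = _⟩
  have hα y : ((e y : ℕ), j) ∈ a ↔ Sat F σ α y :=
    ih _ y ⟨ModelCode.mem_points.2 ⟨(e y).2, (ModelCode.mem_points.1 hq).2⟩, rfl⟩
  cases φ with
  | all => simp [ModelCode.algebra, WLabel.code, hq, Sat, forall_lt_iff_forall_equiv e, hα, maskSet]
  | ex => simp [ModelCode.algebra, WLabel.code, hq, Sat, exists_lt_iff_exists_equiv e, hα, maskSet]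
  | var z =>
    have hz : z ≤ k := (Nat.le_add_right z 2).trans hφ
    simp [ModelCode.algebra, WLabel.code, hq, Sat, hM.world hz, hα, maskSet]

theorem computes_byN {φ : NLabel} (hφ : φ.code ≤ k) {α : Fml .w} {a : List (ℕ × ℕ)}
    (ih : Computes e F σ a α) : Computes e F σ (M.algebra.byN φ.code a) (.byN φ α) := by
  rintro ⟨i, j⟩ x ⟨hq, rfl : i = e x⟩
  have hα {j} (hj : j < 2 ^ M.size) (hS) : ((e x : ℕ), j) ∈ a ↔ Sat F σ α ⟨x, maskSet e j, hS⟩ :=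
    ih _ _ ⟨ModelCode.mem_points.2 ⟨(e x).2, hj⟩, rfl, rfl⟩
  cases φ with
  | all =>
    simp only [ModelCode.algebra, NLabel.code, if_true, List.mem_filter, hq, decide_eq_true_iff,
      true_and, Sat, forall_set_iff_forall_maskSet e]
    exact forall₂_congr fun j hj => ⟨fun h hS => (hα hj hS).1 (h ((hM.nest x hj).2 hS)),
      fun h hb => (hα hj _).2 (h ((hM.nest x hj).1 hb))⟩
  | ex =>
    simp only [ModelCode.algebra, NLabel.code, if_true, one_ne_zero, if_false, List.mem_filter, hq,
      decide_eq_true_iff, true_and, Sat, exists_set_iff_exists_maskSet e]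
    exact exists_congr fun j => and_congr_right fun hj =>
      ⟨fun ⟨hb, h⟩ => ⟨(hM.nest x hj).1 hb, (hα hj _).1 h⟩,
        fun ⟨hS, h⟩ => ⟨(hM.nest x hj).2 hS, (hα hj hS).2 h⟩⟩
  | var N =>
    have hN : N ≤ k := (Nat.le_add_right N 2).trans hφ
    have hβ hS : ((e x : ℕ), M.nbhd N) ∈ a ↔ Sat F σ α ⟨x, σ.nbhd N, hS⟩ :=
      ih _ _ ⟨ModelCode.mem_points.2 ⟨(e x).2, M.nbhd_lt⟩, rfl, hM.nbhd hN⟩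
    have hnest := hM.nest_nbhd_iff hN x
    simp only [ModelCode.algebra, NLabel.code, Nat.add_eq_zero_iff, OfNat.ofNat_ne_zero, and_false,
      Nat.reduceEqDiff, Nat.add_sub_cancel, if_false, List.mem_filter, hq, decide_eq_true_iff,
      true_and, Sat]
    exact ⟨fun ⟨hb, h⟩ => ⟨hnest.1 hb, (hβ _).1 h⟩, fun ⟨hS, h⟩ => ⟨hnest.2 hS, (hβ hS).2 h⟩⟩

theorem computes_eval {s : Kind} {α : Fml s} (hα : α.code ≤ k) :
    Computes e F σ (M.algebra.eval α) α := by
  have right {a b : ℕ} (h : Nat.pair a b ≤ k) : b ≤ k := (Nat.right_le_pair _ _).trans h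
  have left {a b : ℕ} (h : Nat.pair a b ≤ k) : a ≤ k := (Nat.left_le_pair _ _).trans h
  induction α with
  | atom p => exact hM.computes_atom (right hα)
  | incl N => exact hM.computes_incl (right hα)
  | cont N => exact hM.computes_cont (right hα)
  | top => exact fun _ _ h => iff_of_true h.mem_points trivial
  | bot => exact fun _ _ _ => iff_of_false List.not_mem_nil id
  | neg α ih => exact (ih (right hα)).neg
  | and α β ih₁ ih₂ => exact (ih₁ (left (right hα))).and (ih₂ (right (right hα)))
  | or α β ih₁ ih₂ => exact (ih₁ (left (right hα))).or (ih₂ (right (right hα)))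
  | imp α β ih₁ ih₂ => exact (ih₁ (left (right hα))).imp (ih₂ (right (right hα)))
  | byW φ α ih => exact hM.computes_byW (left (right hα)) (ih (right (right hα)))
  | byN φ α ih => exact hM.computes_byN (left (right hα)) (ih (right (right hα)))

end Represents

/-- The conditions under which a code describes a frame and an assignment, up to the variable
number `k`: neighbourhoods of a world are nested, and neighbourhood variables are nonempty. -/
def ModelCode.WellFormed (M : ModelCode) (k : ℕ) : Prop :=
  (∀ x < M.size, ∀ i < 2 ^ M.size, ∀ j < 2 ^ M.size, (M.nest x).testBit i = true →
    (M.nest x).testBit j = true → M.Sub i j ∨ M.Sub j i) ∧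
  ∀ N < k + 1, ∃ y < M.size, (M.nbhd N).testBit y = true

theorem ModelCode.nbhd_nonempty_iff {M : ModelCode} {W : Type*} (e : W ≃ Fin M.size) {N : ℕ} :
    (∃ y < M.size, (M.nbhd N).testBit y = true) ↔ (maskSet e (M.nbhd N)).Nonempty :=
  exists_lt_iff_exists_equiv (P := fun y => (M.nbhd N).testBit y = true) e

theorem Represents.wellFormed {k : ℕ} {M : ModelCode} {W : Type u} {e : W ≃ Fin M.size}
    {F : Frame W} {σ : Assignment W} (hM : Represents k M e F σ) : M.WellFormed k := by
  refine ⟨fun x hx i hi j hj hxi hxj => ?_, fun N hN => ?_⟩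
  · obtain ⟨w, rfl⟩ : ∃ w, (e w : ℕ) = x := ⟨e.symm ⟨x, hx⟩, by simp⟩
    rw [ModelCode.sub_iff e, ModelCode.sub_iff e]
    exact F.nested w _ ((hM.nest w hi).1 hxi) _ ((hM.nest w hj).1 hxj)
  · rw [ModelCode.nbhd_nonempty_iff e, hM.nbhd (Nat.le_of_lt_succ hN)]
    exact σ.nbhd_nonempty N

theorem ModelCode.WellFormed.exists_represents {k : ℕ} {M : ModelCode} (h : M.WellFormed k)
    {W : Type u} [Nonempty W] (e : W ≃ Fin M.size) :
    ∃ (F : Frame W) (σ : Assignment W), Represents k M e F σ := by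
  classical
  let F : Frame W :=
    { nest w := maskSet e '' {j | j < 2 ^ M.size ∧ (M.nest (e w)).testBit j = true}
      nested := by
        rintro w _ ⟨i, ⟨hi, hwi⟩, rfl⟩ _ ⟨j, ⟨hj, hwj⟩, rfl⟩
        simpa only [sub_iff e] using h.1 _ (e w).2 i hi j hj hwi hwj
      val p := maskSet e (M.val p) }
  have size_pos : 0 < M.size := (Nat.zero_le _).trans_lt (e (Classical.arbitrary W)).2
  let σ : Assignment W :=
    { world z := e.symm ⟨M.world z, Nat.mod_lt _ size_pos⟩
      nbhd N := if (maskSet e (M.nbhd N)).Nonempty then maskSet e (M.nbhd N) else Set.univ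
      nbhd_nonempty N := by
        split_ifs with hN
        exacts [hN, Set.univ_nonempty] }
  refine ⟨F, σ, fun _ => rfl, fun w j hj => ⟨fun hb => ⟨j, ⟨hj, hb⟩, rfl⟩, ?_⟩, fun _ => ?_,
    fun hN => (if_pos ?_).symm⟩
  · rintro ⟨i, ⟨hi, hb⟩, hij⟩
    rwa [← maskSet_injOn e hi hj hij]
  · simp [σ]
  · exact (nbhd_nonempty_iff e).1 (h.2 _ (Nat.lt_succ_of_le hN))

theorem exists_represents (k : ℕ) {m : ℕ} {W : Type u} (e : W ≃ Fin m) (F : Frame W)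
    (σ : Assignment W) : ∃ V < (2 ^ m) ^ (k + 1), ∃ E < (2 ^ 2 ^ m) ^ m, ∃ w < m ^ (k + 1),
      ∃ n < (2 ^ m) ^ (k + 1), Represents k (m, V, E, w, n) e F σ := by
  choose mask hmask hset using exists_maskSet_eq e
  obtain ⟨V, hV, hVd⟩ := exists_digit_eq (n := k + 1) fun p _ => hmask (F.val p)
  choose nest hnest hnestb using fun x : ℕ => exists_testBit_iff (2 ^ m) fun j =>
    ∃ w, (e w : ℕ) = x ∧ maskSet e j ∈ F.nest w
  obtain ⟨E, hE, hEd⟩ := exists_digit_eq (n := m) fun x _ => hnest x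
  obtain ⟨w, hw, hwd⟩ := exists_digit_eq (n := k + 1) fun z _ => (e (σ.world z)).2
  obtain ⟨n, hn, hnd⟩ := exists_digit_eq (n := k + 1) fun N _ => hmask (σ.nbhd N)
  refine ⟨V, hV, E, hE, w, hw, n, hn, fun hp => ?_, fun x j hj => ?_,
    fun hz => hwd _ (Nat.lt_succ_of_le hz), fun hN => ?_⟩
  · exact (congrArg _ (hVd _ (Nat.lt_succ_of_le hp))).trans (hset _)
  · refine (Eq.congr_left (congrArg (Nat.testBit · j) (hEd (e x) (e x).2))).trans ?_
    refine (hnestb _ j hj).trans ⟨?_, fun h => ⟨x, rfl, h⟩⟩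
    rintro ⟨y, hyx, h⟩
    rwa [← e.injective (Fin.ext hyx)]
  · exact (congrArg _ (hnd _ (Nat.lt_succ_of_le hN))).trans (hset _)

/-- The number of worlds of the countermodels of a formula with Goedel number `k`. -/
def worldBound (k : ℕ) : ℕ := 2 * 8 ^ (k + 1)

/-- Validity by model checking: `c` holds at all worlds of the models with `worldBound c` worlds
that are given by a well-formed code. The second component of `(x, 0)` is immaterial, since formulas
of `F_n` are evaluated at the first. -/
def CodeValid (c : ℕ) : Prop :=
  ∀ V < (2 ^ worldBound c) ^ (c + 1), ∀ E < (2 ^ 2 ^ worldBound c) ^ worldBound c,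
    ∀ w < worldBound c ^ (c + 1), ∀ n < (2 ^ worldBound c) ^ (c + 1),
      ModelCode.WellFormed (worldBound c, V, E, w, n) c →
        ∀ x < worldBound c, (x, 0) ∈ (ModelCode.algebra (worldBound c, V, E, w, n)).fold c

theorem Represents.mem_fold_code_iff {k : ℕ} {M : ModelCode} {W : Type u} {e : W ≃ Fin M.size}
    {F : Frame W} {σ : Assignment W} (hM : Represents k M e F σ) {φ : Fml .n} (hφ : φ.code ≤ k)
    (x : W) : ((e x : ℕ), 0) ∈ M.algebra.fold φ.code ↔ Sat F σ φ x := by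
  rw [FmlAlgebra.fold_code]
  exact hM.computes_eval hφ _ x ⟨ModelCode.mem_points.2 ⟨(e x).2, by positivity⟩, rfl⟩

theorem valid_iff_codeValid {φ : Fml .n} : Valid.{u} φ ↔ CodeValid φ.code := by
  refine ⟨fun h V _ E _ w _ n _ hM x hx => ?_, fun h => ?_⟩
  · let e : ULift.{u} (Fin (worldBound φ.code)) ≃ Fin (worldBound φ.code) := Equiv.ulift
    have : Nonempty (ULift.{u} (Fin (worldBound φ.code))) := ⟨⟨x, hx⟩⟩
    obtain ⟨F, σ, hF⟩ := hM.exists_represents e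
    exact (hF.mem_fold_code_iff le_rfl ⟨⟨x, hx⟩⟩).2 (h _ F σ _)
  · by_contra hφ
    obtain ⟨W, e, F, σ, x, hx⟩ := exists_finite_countermodel le_rfl hφ
    obtain ⟨V, hV, E, hE, w, hw, n, hn, hF⟩ := exists_represents φ.code e F σ
    exact hx ((hF.mem_fold_code_iff le_rfl x).1
      (h V hV E hE w hw n hn hF.wellFormed _ (e x).2))

/-! ### Primitive recursive model checking -/

section Primrec

variable {α β : Type*} [Primcodable α] [Primcodable β]

theorem primrecPred_imp {p q : α → Prop} (hp : PrimrecPred p) (hq : PrimrecPred q) :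
    PrimrecPred fun a => p a → q a :=
  (hp.not.or hq).of_eq fun _ => imp_iff_not_or.symm

theorem primrecPred_forall_lt {n : α → ℕ} {P : α → ℕ → Prop} (hn : Primrec n) (hP : PrimrecRel P) :
    PrimrecPred fun a => ∀ y < n a, P a y :=
  (PrimrecRel.comp (PrimrecRel.forall_mem_list (R := fun y a => P a y) (hP.comp .snd .fst))
    (Primrec.list_range.comp hn) .id).of_eq fun _ => by simp only [List.mem_range, id]

theorem primrecPred_exists_lt {n : α → ℕ} {P : α → ℕ → Prop} (hn : Primrec n) (hP : PrimrecRel P) :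
    PrimrecPred fun a => ∃ y < n a, P a y :=
  (PrimrecRel.comp (PrimrecRel.exists_mem_list (R := fun y a => P a y) (hP.comp .snd .fst))
    (Primrec.list_range.comp hn) .id).of_eq fun _ => by simp only [List.mem_range, id]

theorem primrec_filter {l : α → List β} {P : α → β → Prop} [DecidableRel P] (hl : Primrec l)
    (hP : PrimrecRel P) : Primrec fun a => (l a).filter fun b => P a b :=
  (PrimrecRel.listFilter (R := fun b a => P a b) (hP.comp .snd .fst)).comp hl .id

theorem primrecRel_mem : PrimrecRel fun (b : β) (l : List β) => b ∈ l :=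
  (PrimrecRel.exists_mem_list (Primrec.eq (α := β)) |>.comp .snd .fst).of_eq fun _ => by simp

theorem primrec_pow : Primrec₂ fun b n : ℕ => b ^ n :=
  (Primrec.nat_rec (f := fun _ => 1) (g := fun (b : ℕ) (p : ℕ × ℕ) => p.2 * b) (.const _)
    (Primrec.nat_mul.comp (.comp .snd .snd) .fst)).of_eq fun b n => by
      induction n with
      | zero => rfl
      | succ n ih => rw [pow_succ, ← ih]

theorem primrecRel_testBit : PrimrecRel fun a i : ℕ => a.testBit i = true :=
  (Primrec.eq.comp (Primrec.nat_mod.comp (Primrec.nat_div.comp .fst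
    (primrec_pow.comp (.const 2) .snd)) (.const 2)) (.const 1)).of_eq fun a => by
      simp [Nat.testBit_eq_decide_div_mod_eq]

theorem primrec_digit {b a i : α → ℕ} (hb : Primrec b) (ha : Primrec a) (hi : Primrec i) :
    Primrec fun x => digit (b x) (a x) (i x) :=
  Primrec.nat_mod.comp (Primrec.nat_div.comp ha (primrec_pow.comp hb hi)) hb

end Primrec

namespace ModelCode

theorem primrec_size : Primrec size := .fst

theorem primrec_two_pow_size : Primrec fun M => 2 ^ size M :=
  primrec_pow.comp (.const 2) primrec_size

theorem primrec_val : Primrec₂ val :=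
  primrec_digit (primrec_two_pow_size.comp .fst) (.comp .fst (.comp .snd .fst)) .snd

theorem primrec_nest : Primrec₂ nest :=
  primrec_digit (primrec_pow.comp (.const 2) (primrec_two_pow_size.comp .fst))
    (.comp .fst (.comp .snd (.comp .snd .fst))) .snd

theorem primrec_world : Primrec₂ world :=
  primrec_digit (primrec_size.comp .fst)
    (.comp .fst (.comp .snd (.comp .snd (.comp .snd .fst)))) .snd

theorem primrec_nbhd : Primrec₂ nbhd :=
  primrec_digit (primrec_two_pow_size.comp .fst)
    (.comp .snd (.comp .snd (.comp .snd (.comp .snd .fst)))) .snd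

theorem primrec_points : Primrec points :=
  Primrec.list_flatMap (Primrec.list_range.comp primrec_size) <|
    Primrec.list_map (Primrec.list_range.comp (primrec_two_pow_size.comp .fst))
      (Primrec.pair (.comp .snd .fst) .snd)

section

variable {α : Type*} [Primcodable α] {M : α → ModelCode} {i j : α → ℕ}

theorem primrecPred_sub (hM : Primrec M) (hi : Primrec i) (hj : Primrec j) :
    PrimrecPred fun a => (M a).Sub (i a) (j a) :=
  primrecPred_forall_lt (primrec_size.comp hM) <|
    primrecPred_imp (primrecRel_testBit.comp (hi.comp .fst) .snd)
      (primrecRel_testBit.comp (hj.comp .fst) .snd)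

theorem primrecPred_nest_testBit (hM : Primrec M) (hi : Primrec i) (hj : Primrec j) :
    PrimrecPred fun a => ((M a).nest (i a)).testBit (j a) = true :=
  primrecRel_testBit.comp (primrec_nest.comp hM hi) hj

end

theorem primrecRel_wellFormed : PrimrecRel WellFormed := by
  refine PrimrecPred.and ?_ ?_
  · refine primrecPred_forall_lt (primrec_size.comp .fst) ?_
    refine primrecPred_forall_lt (primrec_two_pow_size.comp (.comp .fst .fst)) ?_
    refine primrecPred_forall_lt (primrec_two_pow_size.comp (.comp .fst (.comp .fst .fst))) ?_
    have hM : Primrec fun p : (((ModelCode × ℕ) × ℕ) × ℕ) × ℕ => p.1.1.1.1 :=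
      .comp .fst (.comp .fst (.comp .fst .fst))
    have hx : Primrec fun p : (((ModelCode × ℕ) × ℕ) × ℕ) × ℕ => p.1.1.2 :=
      .comp .snd (.comp .fst .fst)
    have hi : Primrec fun p : (((ModelCode × ℕ) × ℕ) × ℕ) × ℕ => p.1.2 := .comp .snd .fst
    exact primrecPred_imp (primrecPred_nest_testBit hM hx hi) <|
      primrecPred_imp (primrecPred_nest_testBit hM hx .snd)
        ((primrecPred_sub hM hi .snd).or (primrecPred_sub hM .snd hi))
  · exact primrecPred_forall_lt (Primrec.succ.comp .snd) <|
      primrecPred_exists_lt (primrec_size.comp (.comp .fst .fst)) <|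
        primrecRel_testBit.comp
          (primrec_nbhd.comp (.comp .fst (.comp .fst .fst)) (.comp .snd .fst)) .snd

theorem primrecRel_nest_testBit_nbhd {σ : Type*} [Primcodable σ]
    {f : ModelCode × σ → ℕ} (hf : Primrec f) :
    PrimrecRel fun (x : ModelCode × σ) (q : ℕ × ℕ) =>
      (x.1.nest q.1).testBit (x.1.nbhd (f x)) = true :=
  primrecPred_nest_testBit (.comp .fst .fst) (.comp .fst .snd)
    (primrec_nbhd.comp (.comp .fst .fst) (hf.comp .fst))

theorem primrec_algebra_byW : Primrec₂ fun M (x : ℕ × List (ℕ × ℕ)) => (algebra M).byW x.1 x.2 := by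
  have hpoints : Primrec fun x : ModelCode × ℕ × List (ℕ × ℕ) => x.1.points :=
    primrec_points.comp .fst
  have hlabel c : PrimrecPred fun x : ModelCode × ℕ × List (ℕ × ℕ) => x.2.1 = c :=
    Primrec.eq.comp (.comp .fst .snd) (.const c)
  have hbit : PrimrecRel fun (x : (ModelCode × ℕ × List (ℕ × ℕ)) × ℕ × ℕ) (y : ℕ) =>
      x.2.2.testBit y = true :=
    primrecRel_testBit.comp (.comp .snd (.comp .snd .fst)) .snd
  have hmem : PrimrecRel fun (x : (ModelCode × ℕ × List (ℕ × ℕ)) × ℕ × ℕ) (y : ℕ) =>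
      (y, x.2.2) ∈ x.1.2.2 :=
    primrecRel_mem.comp (.pair .snd (.comp .snd (.comp .snd .fst)))
      (.comp .snd (.comp .snd (.comp .fst .fst)))
  have hsize : Primrec fun x : (ModelCode × ℕ × List (ℕ × ℕ)) × ℕ × ℕ => x.1.1.size :=
    primrec_size.comp (.comp .fst .fst)
  have hworld : Primrec fun x : (ModelCode × ℕ × List (ℕ × ℕ)) × ℕ × ℕ =>
      x.1.1.world (x.1.2.1 - 2) :=
    primrec_world.comp (.comp .fst .fst)
      (Primrec.nat_sub.comp (.comp .fst (.comp .snd .fst)) (.const 2))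
  exact .ite (hlabel 0)
    (primrec_filter hpoints (primrecPred_forall_lt hsize (primrecPred_imp hbit hmem))) <|
    .ite (hlabel 1) (primrec_filter hpoints (primrecPred_exists_lt hsize (hbit.and hmem)))
      (primrec_filter hpoints ((hbit.comp .id hworld).and (hmem.comp .id hworld)))

theorem primrec_algebra_byN : Primrec₂ fun M (x : ℕ × List (ℕ × ℕ)) => (algebra M).byN x.1 x.2 := by
  have hpoints : Primrec fun x : ModelCode × ℕ × List (ℕ × ℕ) => x.1.points :=
    primrec_points.comp .fst
  have hlabel c : PrimrecPred fun x : ModelCode × ℕ × List (ℕ × ℕ) => x.2.1 = c :=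
    Primrec.eq.comp (.comp .fst .snd) (.const c)
  have hbit : PrimrecRel fun (x : (ModelCode × ℕ × List (ℕ × ℕ)) × ℕ × ℕ) (j : ℕ) =>
      (x.1.1.nest x.2.1).testBit j = true :=
    primrecPred_nest_testBit (.comp .fst (.comp .fst .fst)) (.comp .fst (.comp .snd .fst)) .snd
  have hmem : PrimrecRel fun (x : (ModelCode × ℕ × List (ℕ × ℕ)) × ℕ × ℕ) (j : ℕ) =>
      (x.2.1, j) ∈ x.1.2.2 :=
    primrecRel_mem.comp (.pair (.comp .fst (.comp .snd .fst)) .snd)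
      (.comp .snd (.comp .snd (.comp .fst .fst)))
  have hsize : Primrec fun x : (ModelCode × ℕ × List (ℕ × ℕ)) × ℕ × ℕ => 2 ^ x.1.1.size :=
    primrec_two_pow_size.comp (.comp .fst .fst)
  have hnbhd : Primrec fun x : (ModelCode × ℕ × List (ℕ × ℕ)) × ℕ × ℕ =>
      x.1.1.nbhd (x.1.2.1 - 2) :=
    primrec_nbhd.comp (.comp .fst .fst)
      (Primrec.nat_sub.comp (.comp .fst (.comp .snd .fst)) (.const 2))
  exact .ite (hlabel 0)
    (primrec_filter hpoints (primrecPred_forall_lt hsize (primrecPred_imp hbit hmem))) <|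
    .ite (hlabel 1) (primrec_filter hpoints (primrecPred_exists_lt hsize (hbit.and hmem)))
      (primrec_filter hpoints ((hbit.comp .id hnbhd).and (hmem.comp .id hnbhd)))

theorem algebra_isPrimrec : FmlAlgebra.IsPrimrec algebra where
  junk := .const []
  atom := primrec_filter (primrec_points.comp .fst) <| primrecRel_testBit.comp
    (primrec_val.comp (.comp .fst .fst) (.comp .snd .fst)) (.comp .fst .snd)
  incl := primrec_filter (primrec_points.comp .fst) <| (primrecRel_nest_testBit_nbhd .snd).and <|
    primrecPred_sub (.comp .fst .fst) (primrec_nbhd.comp (.comp .fst .fst) (.comp .snd .fst))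
      (.comp .snd .snd)
  cont := primrec_filter (primrec_points.comp .fst) <| (primrecRel_nest_testBit_nbhd .snd).and <|
    primrecPred_sub (.comp .fst .fst) (.comp .snd .snd)
      (primrec_nbhd.comp (.comp .fst .fst) (.comp .snd .fst))
  top := primrec_points
  bot := .const []
  neg := primrec_filter (primrec_points.comp .fst)
    (primrecRel_mem.comp .snd (.comp .snd .fst)).not
  and := primrec_filter (primrec_points.comp .fst) <|
    (primrecRel_mem.comp .snd (.comp .fst (.comp .snd .fst))).and
      (primrecRel_mem.comp .snd (.comp .snd (.comp .snd .fst)))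
  or := primrec_filter (primrec_points.comp .fst) <|
    (primrecRel_mem.comp .snd (.comp .fst (.comp .snd .fst))).or
      (primrecRel_mem.comp .snd (.comp .snd (.comp .snd .fst)))
  imp := primrec_filter (primrec_points.comp .fst) <|
    (primrecRel_mem.comp .snd (.comp .fst (.comp .snd .fst))).not.or
      (primrecRel_mem.comp .snd (.comp .snd (.comp .snd .fst)))
  byW := primrec_algebra_byW
  byN := primrec_algebra_byN

end ModelCode

theorem primrec_worldBound : Primrec worldBound :=
  Primrec.nat_mul.comp (.const 2) (primrec_pow.comp (.const 8) .succ)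

theorem primrecPred_codeValid : PrimrecPred CodeValid := by
  have hworlds : Primrec fun c => 2 ^ worldBound c := primrec_pow.comp (.const 2) primrec_worldBound
  have hsets : Primrec fun c => (2 ^ worldBound c) ^ (c + 1) := primrec_pow.comp hworlds .succ
  have hnest : Primrec fun c => (2 ^ 2 ^ worldBound c) ^ worldBound c :=
    primrec_pow.comp (primrec_pow.comp (.const 2) hworlds) primrec_worldBound
  have hvars : Primrec fun c => worldBound c ^ (c + 1) :=
    primrec_pow.comp primrec_worldBound .succ
  have hc : Primrec fun x : (((ℕ × ℕ) × ℕ) × ℕ) × ℕ => x.1.1.1.1 :=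
    .comp .fst (.comp .fst (.comp .fst .fst))
  have hM : Primrec fun x : (((ℕ × ℕ) × ℕ) × ℕ) × ℕ =>
      ((worldBound x.1.1.1.1, x.1.1.1.2, x.1.1.2, x.1.2, x.2) : ModelCode) :=
    .pair (primrec_worldBound.comp hc) <| .pair (.comp .snd (.comp .fst (.comp .fst .fst))) <|
      .pair (.comp .snd (.comp .fst .fst)) <| .pair (.comp .snd .fst) .snd
  refine primrecPred_forall_lt hsets ?_
  refine primrecPred_forall_lt (hnest.comp .fst) ?_
  refine primrecPred_forall_lt (hvars.comp (.comp .fst .fst)) ?_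
  refine primrecPred_forall_lt (hsets.comp (.comp .fst (.comp .fst .fst))) ?_
  refine primrecPred_imp (ModelCode.primrecRel_wellFormed.comp hM hc) ?_
  refine primrecPred_forall_lt (primrec_worldBound.comp hc) ?_
  exact primrecRel_mem.comp (.pair .snd (.const 0))
    (ModelCode.algebra_isPrimrec.fold.comp (hM.comp .fst) (hc.comp .fst))

end PUC

theorem mainTheorem4 :
    PUC.DecidableSet (s := .n) PUC.Provable ∧
    PUC.DecidableSet (s := .n) PUC.Valid.{u} ∧
    PUC.DecidableSet (s := .w) PUC.Valid.{u} := by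
  have byN_all : Primrec fun c => Nat.pair 10 (Nat.pair 0 c) :=
    Primrec₂.natPair.comp (.const 10) (Primrec₂.natPair.comp (.const 0) .id)
  refine ⟨.of_primrecPred (PUC.primrecPred_codeValid.comp PUC.primrec_flattenAlgebra_fold) ?_,
    .of_primrecPred PUC.primrecPred_codeValid fun φ => PUC.valid_iff_codeValid,
    .of_primrecPred (PUC.primrecPred_codeValid.comp byN_all) fun φ => ?_⟩
  · intro φ
    rw [PUC.provable_iff_valid_flatten.{u}, PUC.valid_iff_codeValid,
      PUC.FmlAlgebra.fold_code, PUC.flattenAlgebra_eval]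
  · exact PUC.valid_byN_all_iff.symm.trans PUC.valid_iff_codeValid
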